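/- Let $k$ be a field and $G$ a finite group. Let $D(k[G])$ be the Drinfel'd double of $k[G]$: the bialgebra with basis $g\llcorner x$ ($g,x\in G$), multiplication $g\llcorner x\cdot h\llcorner y=\delta_{g,xhx^{-1}}\,g\llcorner xy$, unit $\sum_{g}g\llcorner e$, comultiplication $\Delta(g\llcorner x)=\sum_{g_1g_2=g}g_1\llcorner x\otimes g_2\llcorner x$ and counit $\varepsilon(g\llcorner x)=\delta_{g,e}$. For a $k$-algebra $A$ let $\mathrm{Rep}(A)$ be the Grothendieck group of finite-dimensional left $A$-modules modulo short exact sequences; for a bialgebra it is a ring under $\otimes_k$, with unit the trivial module. For a group $H$ write $\mathrm{Rep}(H)=\mathrm{Rep}(k[H])$. The inertia stack of $[pt/G]$ is the quotient $[G/G]$ of $G$ by conjugation. Let $K_{\rm full}([pt/G])=K([G/G])$ be the Grothendieck group, modulo short exact sequences, of finite-rank $G$-equivariant $k$-vector bundles on the finite set $G$ with conjugation action. Let $e_1,e_2,\check e_3:[(G\times G)/G]\to[G/G]$ be induced by $(m_1,m_2)\mapsto m_1$, $m_2$ and $m_1m_2$. Equip $K_{\rm full}([pt/G])$ with the stringy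 push-pull product $$\mathcal F*\mathcal F'=\check e_{3*}\bigl(e_1^*\mathcal F\otimes e_2^*\mathcal F'\bigr)$$ (the obstruction bundle is zero for a point) and with the class of the trivial line bundle supported on the untwisted sector $\{e\}\subset G$. Then: 1. There is an isomorphism $K_{\rm full}([pt/G])\cong \mathrm{Rep}(D(k[G]))$, additive, multiplicative and carrying the distinguished class above to $1$; in particular $K_{\rm full}([pt/G])$ is an associative ring with that class as unit, and this is an isomorphism of rings (with integral coefficients). 2. For every system of representatives $g_c$ of the conjugacy classes $c$ of $G$, with centralizers $Z(g_c)$, the map sending a bundle $E$ to the family of its fibres $(E_{g_c})_c$, considered as representations of $Z(g_c)$, induces an isomorphism of additive groups $K_{\rm full}([pt/G])\cong\bigoplus_{c}\mathrm{Rep}(Z(g_c))$. -/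

import Mathlib

open scoped TensorProduct DirectSum

universe u v w

noncomputable section

/-! Grothendieck groups -/

/-- The Grothendieck group of a class `T` of objects with a class of short exact sequences
`SES A B C` (read `0 → A → B → C → 0`): generators `[A]`, relations `[B] = [A] + [C]`. -/
def GrothendieckK (T : Type w) (SES : T → T → T → Prop) : Type w :=
  FreeAbelianGroup T ⧸ AddSubgroup.closure
    {z : FreeAbelianGroup T | ∃ A B C, SES A B C ∧
      z = FreeAbelianGroup.of B - FreeAbelianGroup.of A - FreeAbelianGroup.of C}

namespace GrothendieckK

variable {T : Type w} {SES : T → T → T → Prop}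

instance : AddCommGroup (GrothendieckK T SES) :=
  inferInstanceAs (AddCommGroup (FreeAbelianGroup T ⧸ AddSubgroup.closure
    {z : FreeAbelianGroup T | ∃ A B C, SES A B C ∧
      z = FreeAbelianGroup.of B - FreeAbelianGroup.of A - FreeAbelianGroup.of C}))

/-- The class `[A]` of an object. -/
def cls (SES : T → T → T → Prop) (A : T) : GrothendieckK T SES :=
  QuotientAddGroup.mk (FreeAbelianGroup.of A)

theorem cls_eq_add {A B C : T} (h : SES A B C) : cls SES B = cls SES A + cls SES C := by
  have h0 : (QuotientAddGroup.mk (FreeAbelianGroup.of B - FreeAbelianGroup.of A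
      - FreeAbelianGroup.of C) : GrothendieckK T SES) = 0 :=
    (QuotientAddGroup.eq_zero_iff _).2 (AddSubgroup.subset_closure ⟨A, B, C, h, rfl⟩)
  have h1 : cls SES B - cls SES A - cls SES C = 0 := h0
  rw [sub_sub, sub_eq_zero] at h1
  exact h1

/-- An additive invariant of objects factors through the Grothendieck group. -/
def lift {H : Type*} [AddCommGroup H] (f : T → H)
    (hf : ∀ A B C, SES A B C → f B = f A + f C) : GrothendieckK T SES →+ H :=
  QuotientAddGroup.lift _ (FreeAbelianGroup.lift f) (by
    rw [AddSubgroup.closure_le]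
    rintro _ ⟨A, B, C, h, rfl⟩
    simp [hf A B C h])

@[simp]
theorem lift_cls {H : Type*} [AddCommGroup H] (f : T → H)
    (hf : ∀ A B C, SES A B C → f B = f A + f C) (A : T) : lift f hf (cls SES A) = f A := by
  change FreeAbelianGroup.lift f (FreeAbelianGroup.of A) = f A
  simp

theorem hom_ext {H : Type*} [AddCommGroup H] {f g : GrothendieckK T SES →+ H}
    (h : ∀ A, f (cls SES A) = g (cls SES A)) : f = g := by
  apply QuotientAddGroup.addMonoidHom_ext
  apply FreeAbelianGroup.lift_ext
  exact h

/-- A bi-exact operation on objects induces a biadditive operation on the Grothendieck group. -/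
def lift₂ (f : T → T → T)
    (hl : ∀ A B C D, SES A B C → SES (f A D) (f B D) (f C D))
    (hr : ∀ A B C D, SES A B C → SES (f D A) (f D B) (f D C)) :
    GrothendieckK T SES →+ GrothendieckK T SES →+ GrothendieckK T SES :=
  lift (fun D => lift (fun A => cls SES (f D A))
      (fun A B C h => cls_eq_add (hr A B C D h)))
    (fun A B C h => hom_ext fun D => by
      simpa using cls_eq_add (hl A B C D h))

@[simp]
theorem lift₂_cls (f : T → T → T)
    (hl : ∀ A B C D, SES A B C → SES (f A D) (f B D) (f C D))
    (hr : ∀ A B C D, SES A B C → SES (f D A) (f D B) (f D C)) (A B : T) :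
    lift₂ f hl hr (cls SES A) (cls SES B) = cls SES (f A B) := by
  simp [lift₂]

end GrothendieckK

/-! Finite-dimensional modules and the representation ring of a bialgebra -/

/-- A finite-dimensional left module `(ρ, V)` over a `k`-algebra `A`. -/
structure FDModule (k : Type u) [Field k] (A : Type v) [Ring A] [Algebra k A] where
  V : Type (max u v)
  [addCommGroup : AddCommGroup V]
  [module : Module k V]
  [finiteDimensional : FiniteDimensional k V]
  ρ : A →ₐ[k] Module.End k V

namespace FDModule

attribute [instance] addCommGroup module finiteDimensional

variable {k : Type u} [Field k] {A : Type v} [Ring A] [Algebra k A]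

/-- There is a short exact sequence `0 → L → M → N → 0` of `A`-modules. -/
def IsSES (L M N : FDModule k A) : Prop :=
  ∃ (f : L.V →ₗ[k] M.V) (g : M.V →ₗ[k] N.V),
    (∀ a v, f (L.ρ a v) = M.ρ a (f v)) ∧ (∀ a v, g (M.ρ a v) = N.ρ a (g v)) ∧
    Function.Injective f ∧ Function.Exact f g ∧ Function.Surjective g

/-- A finite-dimensional representation of a group `H` as a module over `k[H]`. -/
def ofRepresentation {H : Type v} [Group H] {V : Type (max u v)} [AddCommGroup V] [Module k V]
    [FiniteDimensional k V] (ρ : Representation k H V) : FDModule k (MonoidAlgebra k H) where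
  V := V
  ρ := ρ.asAlgebraHom

end FDModule

/-- `Rep(A)`: the Grothendieck group of finite-dimensional left `A`-modules. -/
abbrev RepRing (k : Type u) [Field k] (A : Type v) [Ring A] [Algebra k A] : Type _ :=
  GrothendieckK (FDModule k A) FDModule.IsSES

/-- The class of a module in `Rep(A)`. -/
abbrev RepRing.cls {k : Type u} [Field k] {A : Type v} [Ring A] [Algebra k A]
    (M : FDModule k A) : RepRing k A :=
  GrothendieckK.cls FDModule.IsSES M

namespace FDModule

variable {k : Type u} [Field k] {A : Type v} [Ring A] [Algebra k A]

theorem cls_zero {Z : FDModule k A} (hZ : Subsingleton Z.V) : RepRing.cls Z = 0 := by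
  have h : IsSES Z Z Z := ⟨LinearMap.id, 0, by simp, by simp, fun _ _ _ => Subsingleton.elim _ _,
    fun x => ⟨fun _ => ⟨x, rfl⟩, fun _ => rfl⟩, fun x => ⟨0, Subsingleton.elim _ _⟩⟩
  have := GrothendieckK.cls_eq_add h
  simpa using this

theorem cls_congr {M N : FDModule k A} (e : M.V ≃ₗ[k] N.V)
    (he : ∀ a v, e (M.ρ a v) = N.ρ a (e v)) : RepRing.cls M = RepRing.cls N := by
  let Z : FDModule k A :=
    { V := PUnit
      ρ := 
        { toFun := fun _ => 0
          map_one' := Subsingleton.elim _ _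
          map_mul' := fun _ _ => Subsingleton.elim _ _
          map_zero' := rfl
          map_add' := fun _ _ => Subsingleton.elim _ _
          commutes' := fun _ => Subsingleton.elim _ _ } }
  have hZ : RepRing.cls Z = 0 := cls_zero (inferInstanceAs (Subsingleton PUnit))
  have h : IsSES M N Z := ⟨e.toLinearMap, 0, he, by simp, e.injective,
    fun x => ⟨fun _ => ⟨e.symm x, by simp⟩, fun _ => rfl⟩, fun x => ⟨0, rfl⟩⟩
  have := GrothendieckK.cls_eq_add h
  rw [show GrothendieckK.cls IsSES Z = 0 from hZ, add_zero] at this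
  exact this.symm

end FDModule

/-- For modules `(ρ, V)` and `(σ, W)`, the action of `A ⊗ A` on `V ⊗ W`. -/
def outerTensorRep {k : Type u} [Field k] {A : Type v} [Ring A] [Algebra k A]
    {V W : Type*} [AddCommGroup V] [Module k V] [AddCommGroup W] [Module k W]
    (ρ : A →ₐ[k] Module.End k V) (σ : A →ₐ[k] Module.End k W) :
    A ⊗[k] A →ₐ[k] Module.End k (V ⊗[k] W) :=
  (Module.endTensorEndAlgHom (R := k) (S := k) (A := k)).comp (Algebra.TensorProduct.map ρ σ)

/-- The action of a bialgebra `A` on `V ⊗ W` through the comultiplication. -/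
def tensorRep {k : Type u} [Field k] {A : Type v} [Ring A] [Bialgebra k A]
    {V W : Type*} [AddCommGroup V] [Module k V] [AddCommGroup W] [Module k W]
    (ρ : A →ₐ[k] Module.End k V) (σ : A →ₐ[k] Module.End k W) :
    A →ₐ[k] Module.End k (V ⊗[k] W) :=
  (outerTensorRep ρ σ).comp (Bialgebra.comulAlgHom k A)

/-- The action of a bialgebra `A` on `k` through the counit. -/
def trivialRep (k : Type u) [Field k] (A : Type v) [Ring A] [Bialgebra k A]
    (V : Type w) [AddCommGroup V] [Module k V] : A →ₐ[k] Module.End k V :=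
  (Algebra.lsmul k k V).comp (Bialgebra.counitAlgHom k A)

section tensorLemmas

variable {k : Type u} [Field k] {A : Type v} [Ring A] [Bialgebra k A]
  {V V' W W' U : Type*} [AddCommGroup V] [Module k V] [AddCommGroup V'] [Module k V']
  [AddCommGroup W] [Module k W] [AddCommGroup W'] [Module k W'] [AddCommGroup U] [Module k U]
  (ρ : A →ₐ[k] Module.End k V) (ρ' : A →ₐ[k] Module.End k V')
  (σ : A →ₐ[k] Module.End k W) (σ' : A →ₐ[k] Module.End k W') (τ : A →ₐ[k] Module.End k U)

theorem tensorRep_apply (a : A) :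
    tensorRep ρ σ a = outerTensorRep ρ σ (Coalgebra.comul (R := k) a) := rfl

@[simp]
theorem outerTensorRep_tmul (a b : A) :
    outerTensorRep ρ σ (a ⊗ₜ b) = TensorProduct.map (ρ a) (σ b) := rfl

theorem outerTensorRep_map (f : V →ₗ[k] V') (g : W →ₗ[k] W')
    (hf : ∀ a v, f (ρ a v) = ρ' a (f v)) (hg : ∀ a v, g (σ a v) = σ' a (g v))
    (t : A ⊗[k] A) (x : V ⊗[k] W) :
    TensorProduct.map f g (outerTensorRep ρ σ t x) =
      outerTensorRep ρ' σ' t (TensorProduct.map f g x) := by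
  induction t with
  | zero => simp
  | add s t hs ht => simp only [map_add, LinearMap.add_apply, hs, ht]
  | tmul a b =>
    induction x with
    | zero => simp
    | add x y hx hy => simp only [map_add, hx, hy]
    | tmul v w => simp [hf, hg]

theorem tensorRep_assoc (a : A) (x : (V ⊗[k] W) ⊗[k] U) :
    TensorProduct.assoc k V W U (tensorRep (tensorRep ρ σ) τ a x) =
      tensorRep ρ (tensorRep σ τ) a (TensorProduct.assoc k V W U x) := by
  let F : (A ⊗[k] A) ⊗[k] A →ₗ[k] Module.End k ((V ⊗[k] W) ⊗[k] U) :=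
    TensorProduct.lift
      ((TensorProduct.mapBilinear (RingHom.id k) (V ⊗[k] W) U (V ⊗[k] W) U).compl₁₂
        (outerTensorRep ρ σ).toLinearMap τ.toLinearMap)
  let F' : A ⊗[k] (A ⊗[k] A) →ₗ[k] Module.End k (V ⊗[k] (W ⊗[k] U)) :=
    TensorProduct.lift
      ((TensorProduct.mapBilinear (RingHom.id k) V (W ⊗[k] U) V (W ⊗[k] U)).compl₁₂
        ρ.toLinearMap (outerTensorRep σ τ).toLinearMap)
  have hF : ∀ t : A ⊗[k] A, outerTensorRep (tensorRep ρ σ) τ t =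
      F (LinearMap.rTensor A (Coalgebra.comul (R := k)) t) := by
    intro t
    induction t with
    | zero => simp
    | add s t hs ht => simp only [map_add, hs, ht]
    | tmul a b => simp [F, tensorRep_apply]
  have hF' : ∀ t : A ⊗[k] A, outerTensorRep ρ (tensorRep σ τ) t =
      F' (LinearMap.lTensor A (Coalgebra.comul (R := k)) t) := by
    intro t
    induction t with
    | zero => simp
    | add s t hs ht => simp only [map_add, hs, ht]
    | tmul a b => simp [F', tensorRep_apply]
  have key : ∀ (t : (A ⊗[k] A) ⊗[k] A) (x : (V ⊗[k] W) ⊗[k] U),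
      TensorProduct.assoc k V W U (F t x) =
        F' (TensorProduct.assoc k A A A t) (TensorProduct.assoc k V W U x) := by
    intro t x
    induction t with
    | zero => simp
    | add s t hs ht => simp only [map_add, LinearMap.add_apply, hs, ht]
    | tmul t c =>
      induction t with
      | zero => simp
      | add s t hs ht => simp only [map_add, TensorProduct.add_tmul, LinearMap.add_apply, hs, ht]
      | tmul a b =>
        induction x with
        | zero => simp
        | add x y hx hy => simp only [map_add, hx, hy]
        | tmul y w =>
          induction y with
          | zero => simp
          | add x y hx hy => simp only [map_add, TensorProduct.add_tmul, hx, hy]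
          | tmul u v => simp [F, F']
  rw [tensorRep_apply, tensorRep_apply, hF, hF', key, Coalgebra.coassoc_apply]

theorem trivialRep_tensorRep (e : W ≃ₗ[k] k) (a : A) (x : W ⊗[k] V) :
    (TensorProduct.congr e (LinearEquiv.refl k V) ≪≫ₗ TensorProduct.lid k V)
      (tensorRep (trivialRep k A W) ρ a x) =
    ρ a ((TensorProduct.congr e (LinearEquiv.refl k V) ≪≫ₗ TensorProduct.lid k V) x) := by
  have key : ∀ t : A ⊗[k] A,
      (TensorProduct.congr e (LinearEquiv.refl k V) ≪≫ₗ TensorProduct.lid k V)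
        (outerTensorRep (trivialRep k A W) ρ t x) =
      ρ (TensorProduct.lid k A (LinearMap.rTensor A (Coalgebra.counit (R := k)) t))
        ((TensorProduct.congr e (LinearEquiv.refl k V) ≪≫ₗ TensorProduct.lid k V) x) := by
    intro t
    induction t with
    | zero => simp
    | add s t hs ht => simp only [map_add, LinearMap.add_apply, hs, ht]
    | tmul a b =>
      induction x with
      | zero => simp
      | add x y hx hy => simp only [map_add, hx, hy]
      | tmul r v => simp [trivialRep, smul_smul, mul_comm]
  rw [tensorRep_apply, key, Coalgebra.rTensor_counit_comul]
  simp

theorem tensorRep_trivialRep (e : W ≃ₗ[k] k) (a : A) (x : V ⊗[k] W) :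
    (TensorProduct.congr (LinearEquiv.refl k V) e ≪≫ₗ TensorProduct.rid k V)
      (tensorRep ρ (trivialRep k A W) a x) =
    ρ a ((TensorProduct.congr (LinearEquiv.refl k V) e ≪≫ₗ TensorProduct.rid k V) x) := by
  have key : ∀ t : A ⊗[k] A,
      (TensorProduct.congr (LinearEquiv.refl k V) e ≪≫ₗ TensorProduct.rid k V)
        (outerTensorRep ρ (trivialRep k A W) t x) =
      ρ (TensorProduct.rid k A (LinearMap.lTensor A (Coalgebra.counit (R := k)) t))
        ((TensorProduct.congr (LinearEquiv.refl k V) e ≪≫ₗ TensorProduct.rid k V) x) := by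
    intro t
    induction t with
    | zero => simp
    | add s t hs ht => simp only [map_add, LinearMap.add_apply, hs, ht]
    | tmul a b =>
      induction x with
      | zero => simp
      | add x y hx hy => simp only [map_add, hx, hy]
      | tmul r v => simp [trivialRep, smul_smul, mul_comm]
  rw [tensorRep_apply, key, Coalgebra.lTensor_counit_comul]
  simp

end tensorLemmas

namespace FDModule

variable {k : Type u} [Field k] {A : Type v} [Ring A] [Bialgebra k A]

/-- The tensor product of two modules. -/
def tensor (M N : FDModule k A) : FDModule k A where
  V := M.V ⊗[k] N.V
  ρ := tensorRep M.ρ N.ρ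

/-- The trivial one-dimensional module. -/
def trivial (k : Type u) [Field k] (A : Type v) [Ring A] [Bialgebra k A] : FDModule k A where
  V := ULift.{v} k
  ρ := trivialRep k A (ULift.{v} k)

theorem isSES_tensor_left (L M N D : FDModule k A) (h : IsSES L M N) :
    IsSES (tensor L D) (tensor M D) (tensor N D) := by
  obtain ⟨f, g, hf, hg, hi, he, hs⟩ := h
  refine ⟨f.rTensor D.V, g.rTensor D.V, fun a v => ?_, fun a v => ?_, ?_, ?_, ?_⟩
  · exact outerTensorRep_map _ _ _ _ f LinearMap.id hf (fun _ _ => rfl) _ v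
  · exact outerTensorRep_map _ _ _ _ g LinearMap.id hg (fun _ _ => rfl) _ v
  · exact Module.Flat.rTensor_preserves_injective_linearMap f hi
  · exact rTensor_exact D.V he hs
  · exact LinearMap.rTensor_surjective D.V hs

theorem isSES_tensor_right (L M N D : FDModule k A) (h : IsSES L M N) :
    IsSES (tensor D L) (tensor D M) (tensor D N) := by
  obtain ⟨f, g, hf, hg, hi, he, hs⟩ := h
  refine ⟨f.lTensor D.V, g.lTensor D.V, fun a v => ?_, fun a v => ?_, ?_, ?_, ?_⟩
  · exact outerTensorRep_map _ _ _ _ LinearMap.id f (fun _ _ => rfl) hf _ v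
  · exact outerTensorRep_map _ _ _ _ LinearMap.id g (fun _ _ => rfl) hg _ v
  · exact Module.Flat.lTensor_preserves_injective_linearMap f hi
  · exact lTensor_exact D.V he hs
  · exact LinearMap.lTensor_surjective D.V hs

end FDModule

namespace RepRing

variable {k : Type u} [Field k] {A : Type v} [Ring A] [Bialgebra k A]

/-- The product of `Rep(A)`, induced by the tensor product of modules. -/
def mulHom : RepRing k A →+ RepRing k A →+ RepRing k A :=
  GrothendieckK.lift₂ FDModule.tensor FDModule.isSES_tensor_left FDModule.isSES_tensor_right

instance : Mul (RepRing k A) := ⟨fun x y => mulHom x y⟩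

instance : One (RepRing k A) := ⟨cls (FDModule.trivial k A)⟩

theorem cls_mul_cls (M N : FDModule k A) : cls M * cls N = cls (FDModule.tensor M N) :=
  GrothendieckK.lift₂_cls _ _ _ _ _

theorem one_def : (1 : RepRing k A) = cls (FDModule.trivial k A) := rfl

theorem mul_def (x y : RepRing k A) : x * y = mulHom x y := rfl

/-- The representation ring `Rep(A)` of a bialgebra `A`. -/
instance : Ring (RepRing k A) :=
  { (inferInstance : AddCommGroup (RepRing k A)) with
    mul := (· * ·)
    one := 1
    left_distrib := fun x y z => map_add (mulHom x) y z
    right_distrib := fun x y z => DFunLike.congr_fun (map_add mulHom x y) z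
    zero_mul := fun x => DFunLike.congr_fun (map_zero mulHom) x
    mul_zero := fun x => map_zero (mulHom x)
    one_mul := by
      intro x
      have : mulHom (1 : RepRing k A) = AddMonoidHom.id _ := GrothendieckK.hom_ext fun M =>
        (cls_mul_cls _ M).trans
          (FDModule.cls_congr _ (trivialRep_tensorRep M.ρ ULift.moduleEquiv))
      exact DFunLike.congr_fun this x
    mul_one := by
      intro x
      have : mulHom.flip (1 : RepRing k A) = AddMonoidHom.id _ := GrothendieckK.hom_ext fun M =>
        (cls_mul_cls M _).trans
          (FDModule.cls_congr _ (tensorRep_trivialRep M.ρ ULift.moduleEquiv))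
      exact DFunLike.congr_fun this x
    mul_assoc := by
      intro x y z
      have h0 : ∀ L M N : FDModule k A, cls L * cls M * cls N = cls L * (cls M * cls N) := by
        intro L M N
        rw [cls_mul_cls, cls_mul_cls, cls_mul_cls, cls_mul_cls]
        exact FDModule.cls_congr (TensorProduct.assoc k L.V M.V N.V)
          (tensorRep_assoc L.ρ M.ρ N.ρ)
      have h1 : ∀ (L M : FDModule k A), mulHom (mulHom (cls L) (cls M)) =
          (mulHom (cls L)).comp (mulHom (cls M)) :=
        fun L M => GrothendieckK.hom_ext fun N => h0 L M N
      have h2 : ∀ (L : FDModule k A) (z : RepRing k A),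
          (mulHom.flip z).comp (mulHom (cls L)) = (mulHom (cls L)).comp (mulHom.flip z) :=
        fun L z => GrothendieckK.hom_ext fun M => DFunLike.congr_fun (h1 L M) z
      have h3 : (mulHom.flip z).comp (mulHom.flip y) = mulHom.flip (mulHom y z) :=
        GrothendieckK.hom_ext fun L => DFunLike.congr_fun (h2 L z) y
      exact DFunLike.congr_fun h3 x }

end RepRing

/-! The Drinfel'd double of a group ring -/

/-- The underlying vector space of the Drinfel'd double `D(k[G])`, with basis indexed by pairs
`(g, x)`. -/
def DrinfeldDouble (k : Type u) [Field k] (G : Type v) : Type (max u v) := (G × G) →₀ k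

namespace DrinfeldDouble

variable {k : Type u} [Field k] {G : Type v}

instance : AddCommGroup (DrinfeldDouble k G) := inferInstanceAs (AddCommGroup ((G × G) →₀ k))

instance : Module k (DrinfeldDouble k G) := inferInstanceAs (Module k ((G × G) →₀ k))

/-- The basis element usually written as `g` and `x` separated by a corner. -/
def elt (k : Type u) [Field k] {G : Type v} (g x : G) : DrinfeldDouble k G :=
  Finsupp.single (g, x) (1 : k)

/-- The elements `elt k g x` form a basis. -/
def basis (k : Type u) [Field k] (G : Type v) : Module.Basis (G × G) k (DrinfeldDouble k G) :=
  Module.Basis.ofRepr (LinearEquiv.refl k ((G × G) →₀ k))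

@[simp]
theorem basis_apply (p : G × G) : basis k G p = elt k p.1 p.2 := rfl

theorem hom_ext {M : Type*} [AddCommGroup M] [Module k M] {f f' : DrinfeldDouble k G →ₗ[k] M}
    (h : ∀ g x, f (elt k g x) = f' (elt k g x)) : f = f' :=
  (basis k G).ext fun p => h p.1 p.2

/-- The unit is `∑ g, (g, e)`. -/
instance [Group G] [Fintype G] : One (DrinfeldDouble k G) := ⟨∑ g : G, elt k g 1⟩

theorem one_def [Group G] [Fintype G] : (1 : DrinfeldDouble k G) = ∑ g : G, elt k g 1 := rfl

variable [Group G] [DecidableEq G]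

/-- The bilinear multiplication determined on basis elements by
`(g, x) (h, y) = δ_{g, x h x⁻¹} (g, x y)`. -/
def mulHom : DrinfeldDouble k G →ₗ[k] DrinfeldDouble k G →ₗ[k] DrinfeldDouble k G :=
  (basis k G).constr k fun p => (basis k G).constr k fun q =>
    if p.1 = p.2 * q.1 * p.2⁻¹ then elt k p.1 (p.2 * q.2) else 0

instance : Mul (DrinfeldDouble k G) := ⟨fun a b => mulHom a b⟩

theorem mul_def (a b : DrinfeldDouble k G) : a * b = mulHom a b := rfl

theorem elt_mul_elt (g x h y : G) :
    elt k g x * elt k h y = if g = x * h * x⁻¹ then elt k g (x * y) else 0 := by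
  have h1 : elt k g x = basis k G (g, x) := rfl
  have h2 : elt k h y = basis k G (h, y) := rfl
  rw [mul_def, mulHom, h1, h2, Module.Basis.constr_basis, Module.Basis.constr_basis]

theorem mulHom_elt (g x h y : G) : mulHom (elt k g x) (elt k h y) =
    if g = x * h * x⁻¹ then elt k g (x * y) else 0 := elt_mul_elt g x h y

variable [Fintype G]

instance : Ring (DrinfeldDouble k G) :=
  { (inferInstance : AddCommGroup (DrinfeldDouble k G)) with
    mul := (· * ·)
    one := 1
    left_distrib := fun a b c => map_add (mulHom a) b c
    right_distrib := fun a b c => DFunLike.congr_fun (map_add mulHom a b) c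
    zero_mul := fun a => DFunLike.congr_fun (map_zero mulHom) a
    mul_zero := fun a => map_zero (mulHom a)
    one_mul := by
      intro a
      have : mulHom (1 : DrinfeldDouble k G) = LinearMap.id := hom_ext fun h y => by
        simp [one_def, mulHom_elt]
      exact DFunLike.congr_fun this a
    mul_one := by
      intro a
      have : mulHom.flip (1 : DrinfeldDouble k G) = LinearMap.id := hom_ext fun g x => by
        rw [LinearMap.flip_apply]
        simp only [one_def, map_sum, mulHom_elt, mul_one, LinearMap.id_apply]
        rw [Finset.sum_eq_single (x⁻¹ * g * x)]
        · simp [mul_assoc]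
        · intro b _ hb
          rw [if_neg]
          rintro rfl
          simp [mul_assoc] at hb
        · simp
      exact DFunLike.congr_fun this a
    mul_assoc := by
      have h0 : ∀ g x h y l z : G, mulHom (mulHom (elt k g x) (elt k h y)) (elt k l z) =
          mulHom (elt k g x) (mulHom (elt k h y) (elt k l z)) := by
        intro g x h y l z
        simp only [mulHom_elt]
        by_cases h1 : h = y * l * y⁻¹
        · subst h1
          by_cases h2 : g = x * (y * l * y⁻¹) * x⁻¹
          · subst h2
            simp [mulHom_elt, mul_assoc]
          · simp [h2, mulHom_elt]
        · by_cases h2 : g = x * h * x⁻¹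
          · subst h2
            have h3 : ¬ (x * h * x⁻¹ = x * y * l * (x * y)⁻¹) := by
              intro h4
              apply h1
              have h5 : x * h * x⁻¹ = x * (y * l * y⁻¹) * x⁻¹ := h4.trans (by group)
              exact mul_left_cancel (mul_right_cancel h5)
            rw [if_pos rfl, if_neg h1, map_zero, mulHom_elt, if_neg h3]
          · simp [h1, h2]
      have h1 : ∀ g x h y : G, mulHom (mulHom (elt k g x) (elt k h y)) =
          (mulHom (elt k g x)).comp (mulHom (elt k h y)) :=
        fun g x h y => hom_ext fun l z => h0 g x h y l z
      have h2 : ∀ (g x : G) (c : DrinfeldDouble k G), (mulHom.flip c).comp (mulHom (elt k g x)) =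
          (mulHom (elt k g x)).comp (mulHom.flip c) :=
        fun g x c => hom_ext fun h y => DFunLike.congr_fun (h1 g x h y) c
      intro a b c
      have h3 : (mulHom.flip c).comp (mulHom.flip b) = mulHom.flip (mulHom b c) :=
        hom_ext fun g x => DFunLike.congr_fun (h2 g x c) b
      exact DFunLike.congr_fun h3 a }

instance : Algebra k (DrinfeldDouble k G) :=
  Algebra.ofModule (fun r a b => DFunLike.congr_fun (map_smul mulHom r a) b)
    (fun r a b => map_smul (mulHom a) r b)

theorem algHom_ext {B : Type*} [Ring B] [Algebra k B] {f f' : DrinfeldDouble k G →ₐ[k] B}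
    (h : ∀ g x, f (elt k g x) = f' (elt k g x)) : f = f' :=
  AlgHom.toLinearMap_injective (hom_ext h)

/-- A linear map which is unital and multiplicative on basis elements is an algebra morphism. -/
def algHomOfBasis {B : Type*} [Ring B] [Algebra k B] (f : DrinfeldDouble k G →ₗ[k] B)
    (h1 : f 1 = 1)
    (hmul : ∀ g x h y, f (elt k g x * elt k h y) = f (elt k g x) * f (elt k h y)) :
    DrinfeldDouble k G →ₐ[k] B :=
  AlgHom.ofLinearMap f h1 (by
    intro a b
    have h2 : ∀ g x, f.comp (mulHom (elt k g x)) = (LinearMap.mulLeft k (f (elt k g x))).comp f :=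
      fun g x => hom_ext fun h y => hmul g x h y
    have h3 : f.comp (mulHom.flip b) = (LinearMap.mulRight k (f b)).comp f :=
      hom_ext fun g x => DFunLike.congr_fun (h2 g x) b
    exact DFunLike.congr_fun h3 a)

/-- `Δ(g, x) = ∑_{g₁ g₂ = g} (g₁, x) ⊗ (g₂, x)` as a linear map. -/
def comulLin : DrinfeldDouble k G →ₗ[k] DrinfeldDouble k G ⊗[k] DrinfeldDouble k G :=
  (basis k G).constr k fun p =>
    ∑ q : G × G with q.1 * q.2 = p.1, elt k q.1 p.2 ⊗ₜ[k] elt k q.2 p.2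

theorem comulLin_elt (g x : G) : comulLin (elt k g x) =
    ∑ q : G × G with q.1 * q.2 = g, elt k q.1 x ⊗ₜ[k] elt k q.2 x := by
  have h1 : elt k g x = basis k G (g, x) := rfl
  rw [comulLin, h1, Module.Basis.constr_basis]

/-- `ε(g, x) = δ_{g, e}` as a linear map. -/
def counitLin : DrinfeldDouble k G →ₗ[k] k :=
  (basis k G).constr k fun p => if p.1 = 1 then 1 else 0

theorem counitLin_elt (g x : G) : counitLin (elt k g x) = if g = 1 then (1 : k) else 0 := by
  have h1 : elt k g x = basis k G (g, x) := rfl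
  rw [counitLin, h1, Module.Basis.constr_basis]

theorem comulLin_elt' (g x : G) : comulLin (elt k g x) =
    ∑ a : G, elt k a x ⊗ₜ[k] elt k (a⁻¹ * g) x := by
  rw [comulLin_elt]
  symm
  refine Finset.sum_bij (fun a _ => (a, a⁻¹ * g)) ?_ ?_ ?_ ?_
  · simp
  · intro a _ b _ h
    exact (Prod.ext_iff.1 h).1
  · rintro ⟨a, b⟩ h
    have h' : a * b = g := by simpa using h
    exact ⟨a, Finset.mem_univ _, by simp [← h']⟩
  · intro a _
    rfl

/-- The comultiplication of `D(k[G])`. -/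
def comulAlg : DrinfeldDouble k G →ₐ[k] DrinfeldDouble k G ⊗[k] DrinfeldDouble k G :=
  algHomOfBasis comulLin
    (by
      simp only [one_def, map_sum, comulLin_elt', Algebra.TensorProduct.one_def,
        TensorProduct.sum_tmul, TensorProduct.tmul_sum]
      rw [Finset.sum_comm]
      rw [Finset.sum_comm (f := fun (b : G) (a : G) => elt k a (1 : G) ⊗ₜ[k] elt k b (1 : G))]
      refine Finset.sum_congr rfl fun a _ => ?_
      exact Fintype.sum_equiv (Equiv.mulLeft a⁻¹) _ _ fun _ => rfl)
    (by
      intro g x h y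
      rw [elt_mul_elt]
      simp only [comulLin_elt', Finset.sum_mul_sum, Algebra.TensorProduct.tmul_mul_tmul,
        elt_mul_elt]
      have key : ∀ a : G, (∑ b : G, (if a = x * b * x⁻¹ then elt k a (x * y) else 0) ⊗ₜ[k]
          (if a⁻¹ * g = x * (b⁻¹ * h) * x⁻¹ then elt k (a⁻¹ * g) (x * y) else 0)) =
          if g = x * h * x⁻¹ then elt k a (x * y) ⊗ₜ[k] elt k (a⁻¹ * g) (x * y) else 0 := by
        intro a
        rw [Finset.sum_eq_single (x⁻¹ * a * x)]
        · rw [if_pos (by group)]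
          have : (a⁻¹ * g = x * ((x⁻¹ * a * x)⁻¹ * h) * x⁻¹) ↔ g = x * h * x⁻¹ := by
            simp [mul_assoc]
          by_cases hg : g = x * h * x⁻¹
          · rw [if_pos hg, if_pos (this.2 hg)]
          · rw [if_neg hg, if_neg (mt this.1 hg), TensorProduct.tmul_zero]
        · intro b _ hb
          rw [if_neg, TensorProduct.zero_tmul]
          rintro rfl
          apply hb
          group
        · simp
      simp only [key]
      by_cases hg : g = x * h * x⁻¹
      · simp [hg, comulLin_elt']
      · simp [hg])

/-- The counit of `D(k[G])`. -/
def counitAlg : DrinfeldDouble k G →ₐ[k] k :=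
  algHomOfBasis counitLin
    (by simp [one_def, counitLin_elt])
    (by
      intro g x h y
      rw [elt_mul_elt]
      by_cases h1 : h = 1
      · subst h1
        by_cases hg : g = 1 <;> simp [hg, counitLin_elt]
      · by_cases hg : g = x * h * x⁻¹
        · simp [hg, counitLin_elt, h1]
        · simp [hg, counitLin_elt, h1])

theorem comulAlg_elt (g x : G) : comulAlg (elt k g x) =
    ∑ a : G, elt k a x ⊗ₜ[k] elt k (a⁻¹ * g) x := comulLin_elt' g x

theorem counitAlg_elt (g x : G) : counitAlg (elt k g x) = if g = 1 then (1 : k) else 0 :=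
  counitLin_elt g x

/-- The bialgebra structure of the Drinfel'd double. -/
instance : Bialgebra k (DrinfeldDouble k G) :=
  Bialgebra.ofAlgHom comulAlg counitAlg
    (algHom_ext fun g x => by
      simp only [AlgHom.comp_apply, comulAlg_elt, map_sum, Algebra.TensorProduct.map_tmul,
        TensorProduct.sum_tmul, TensorProduct.tmul_sum, AlgHom.id_apply]
      rw [Finset.sum_comm]
      refine Finset.sum_congr rfl fun a _ => ?_
      refine Fintype.sum_equiv (Equiv.mulLeft a⁻¹) _ _ fun b => ?_
      simp [mul_assoc])
    (algHom_ext fun g x => by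
      have h : ∀ a : G, (if a = 1 then (1 : k) else 0) ⊗ₜ[k] elt k (a⁻¹ * g) x =
          if a = 1 then (1 : k) ⊗ₜ[k] elt k (a⁻¹ * g) x else 0 := by
        intro a; split_ifs <;> simp
      simp [comulAlg_elt, counitAlg_elt, h])
    (algHom_ext fun g x => by
      have h : ∀ a : G, elt k a x ⊗ₜ[k] (if a = g then (1 : k) else 0) =
          if a = g then elt k a x ⊗ₜ[k] (1 : k) else 0 := by
        intro a; split_ifs <;> simp
      simp [comulAlg_elt, counitAlg_elt, inv_mul_eq_one, h])

theorem comul_elt (g x : G) : Coalgebra.comul (R := k) (elt k g x) =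
    ∑ q : G × G with q.1 * q.2 = g, elt k q.1 x ⊗ₜ[k] elt k q.2 x := comulLin_elt g x

theorem counit_elt (g x : G) :
    Coalgebra.counit (R := k) (elt k g x) = if g = 1 then (1 : k) else 0 := counitLin_elt g x

end DrinfeldDouble

/-! Equivariant vector bundles over finite sets, that is, vector bundles over the quotient
stacks `[X/Γ]` for finite `Γ`-sets `X` -/

/-- A `Γ`-equivariant vector bundle over a discrete `Γ`-set `X`: a family of finite-dimensional
vector spaces and, for `g • x = y`, a linear map from the fibre at `x` to the fibre at `y`,
compatible with the group law. (Equivalently, a functor from the action groupoid of `X` to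
finite-dimensional vector spaces.) -/
structure EquivariantBundle (k : Type u) [Field k] (Γ : Type v) [Group Γ]
    (X : Type v) [MulAction Γ X] where
  fib : X → Type (max u v)
  [addCommGroup : ∀ x, AddCommGroup (fib x)]
  [module : ∀ x, Module k (fib x)]
  [finiteDimensional : ∀ x, FiniteDimensional k (fib x)]
  act : ∀ (g : Γ) {x y : X}, g • x = y → (fib x →ₗ[k] fib y)
  act_one : ∀ x, act 1 (one_smul Γ x) = LinearMap.id
  act_mul : ∀ (g h : Γ) {x y z : X} (hx : h • x = y) (hy : g • y = z),
    act (g * h) (by rw [mul_smul, hx, hy]) = act g hy ∘ₗ act h hx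

namespace EquivariantBundle

attribute [instance] addCommGroup module finiteDimensional

variable {k : Type u} [Field k] {Γ : Type v} [Group Γ] {X Y : Type v} [MulAction Γ X]
  [MulAction Γ Y]

/-- There is a short exact sequence `0 → L → M → N → 0` of equivariant bundles. -/
def IsSES (L M N : EquivariantBundle k Γ X) : Prop :=
  ∃ (f : ∀ x, L.fib x →ₗ[k] M.fib x) (g : ∀ x, M.fib x →ₗ[k] N.fib x),
    (∀ (γ : Γ) {x y : X} (h : γ • x = y) (v : L.fib x), f y (L.act γ h v) = M.act γ h (f x v)) ∧
    (∀ (γ : Γ) {x y : X} (h : γ • x = y) (v : M.fib x), g y (M.act γ h v) = N.act γ h (g x v)) ∧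
    ∀ x, Function.Injective (f x) ∧ Function.Exact (f x) (g x) ∧ Function.Surjective (g x)

/-- The trivial line bundle. -/
def trivial (k : Type u) [Field k] (Γ : Type v) [Group Γ] (X : Type v) [MulAction Γ X] :
    EquivariantBundle k Γ X where
  fib _ := ULift.{v} k
  act _ _ _ _ := LinearMap.id
  act_one _ := rfl
  act_mul _ _ _ _ _ _ _ := rfl

/-- The tensor product of equivariant bundles. -/
def tensor (M N : EquivariantBundle k Γ X) : EquivariantBundle k Γ X where
  fib x := M.fib x ⊗[k] N.fib x
  act g _ _ h := TensorProduct.map (M.act g h) (N.act g h)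
  act_one x := by rw [M.act_one, N.act_one, TensorProduct.map_id]
  act_mul g h _ _ _ hx hy := by rw [M.act_mul g h hx hy, N.act_mul g h hx hy, TensorProduct.map_comp]

/-- The pullback `f^* M` along an equivariant map. -/
def pullback (f : Y →[Γ] X) (M : EquivariantBundle k Γ X) : EquivariantBundle k Γ Y where
  fib y := M.fib (f y)
  act g x _ h := M.act g (x := f x) (by rw [← map_smul, h])
  act_one y := M.act_one (f y)
  act_mul g h _ _ _ _ _ := M.act_mul g h _ _

theorem pushforward_aux (f : Y →[Γ] X) (g : Γ) {x x' : X} (h : g • x = x')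
    (y : {y : Y // f y = x'}) : f (g⁻¹ • y.1) = x := by
  rw [map_smul, y.2, ← h, inv_smul_smul]

/-- The pushforward `f_* M` along an equivariant map of finite sets: the fibre at `x` is the
(finite) direct sum of the fibres of `M` over the points of `f⁻¹(x)`. -/
def pushforward [Finite Y] (f : Y →[Γ] X) (M : EquivariantBundle k Γ Y) :
    EquivariantBundle k Γ X where
  fib x := ∀ y : {y : Y // f y = x}, M.fib y.1
  act g _ _ h :=
    LinearMap.pi fun y =>
      M.act g (smul_inv_smul g y.1) ∘ₗ
        LinearMap.proj (⟨g⁻¹ • y.1, pushforward_aux f g h y⟩ : {y : Y // f y = _})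
  act_one x := by
    ext v y
    have key : ∀ (z : {y : Y // f y = x}) (hz : (1 : Γ) • z.1 = y.1), M.act 1 hz (v z) = v y := by
      intro z hz
      have : z = y := Subtype.ext ((one_smul Γ z.1).symm.trans hz)
      subst this
      exact DFunLike.congr_fun (M.act_one z.1) (v z)
    exact key ⟨(1 : Γ)⁻¹ • y.1, _⟩ _
  act_mul g h x x' x'' hx hy := by
    ext v y
    have key : ∀ (z z' : {y : Y // f y = x}) (w : Y) (hz : (g * h) • z.1 = y.1)
        (hw : h • z'.1 = w) (hy : g • w = y.1),
        M.act (g * h) hz (v z) = M.act g hy (M.act h hw (v z')) := by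
      intro z z' w hz hw hy
      have : z = z' := by
        apply Subtype.ext
        apply MulAction.injective (g * h)
        change (g * h) • z.1 = (g * h) • z'.1
        rw [hz, mul_smul, hw, hy]
      subst this
      exact DFunLike.congr_fun (M.act_mul g h hw hy) (v z)
    exact key ⟨(g * h)⁻¹ • y.1, _⟩ ⟨h⁻¹ • g⁻¹ • y.1, _⟩ (g⁻¹ • y.1) _ _ _

theorem isSES_tensor_left (L M N D : EquivariantBundle k Γ X) (h : IsSES L M N) :
    IsSES (tensor L D) (tensor M D) (tensor N D) := by
  obtain ⟨f, g, hf, hg, he⟩ := h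
  refine ⟨fun x => (f x).rTensor (D.fib x), fun x => (g x).rTensor (D.fib x),
    fun γ x y h v => ?_, fun γ x y h v => ?_, fun x => ⟨?_, ?_, ?_⟩⟩
  · have : (f y).rTensor (D.fib y) ∘ₗ TensorProduct.map (L.act γ h) (D.act γ h) =
        TensorProduct.map (M.act γ h) (D.act γ h) ∘ₗ (f x).rTensor (D.fib x) :=
      TensorProduct.ext' fun v w => by simp [hf]
    exact DFunLike.congr_fun this v
  · have : (g y).rTensor (D.fib y) ∘ₗ TensorProduct.map (M.act γ h) (D.act γ h) =
        TensorProduct.map (N.act γ h) (D.act γ h) ∘ₗ (g x).rTensor (D.fib x) :=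
      TensorProduct.ext' fun v w => by simp [hg]
    exact DFunLike.congr_fun this v
  · exact Module.Flat.rTensor_preserves_injective_linearMap _ (he x).1
  · exact rTensor_exact _ (he x).2.1 (he x).2.2
  · exact LinearMap.rTensor_surjective _ (he x).2.2

theorem isSES_tensor_right (L M N D : EquivariantBundle k Γ X) (h : IsSES L M N) :
    IsSES (tensor D L) (tensor D M) (tensor D N) := by
  obtain ⟨f, g, hf, hg, he⟩ := h
  refine ⟨fun x => (f x).lTensor (D.fib x), fun x => (g x).lTensor (D.fib x),
    fun γ x y h v => ?_, fun γ x y h v => ?_, fun x => ⟨?_, ?_, ?_⟩⟩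
  · have : (f y).lTensor (D.fib y) ∘ₗ TensorProduct.map (D.act γ h) (L.act γ h) =
        TensorProduct.map (D.act γ h) (M.act γ h) ∘ₗ (f x).lTensor (D.fib x) :=
      TensorProduct.ext' fun v w => by simp [hf]
    exact DFunLike.congr_fun this v
  · have : (g y).lTensor (D.fib y) ∘ₗ TensorProduct.map (D.act γ h) (M.act γ h) =
        TensorProduct.map (D.act γ h) (N.act γ h) ∘ₗ (g x).lTensor (D.fib x) :=
      TensorProduct.ext' fun v w => by simp [hg]
    exact DFunLike.congr_fun this v
  · exact Module.Flat.lTensor_preserves_injective_linearMap _ (he x).1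
  · exact lTensor_exact _ (he x).2.1 (he x).2.2
  · exact LinearMap.lTensor_surjective _ (he x).2.2

theorem isSES_pullback (p : Y →[Γ] X) (L M N : EquivariantBundle k Γ X) (h : IsSES L M N) :
    IsSES (pullback p L) (pullback p M) (pullback p N) := by
  obtain ⟨f, g, hf, hg, he⟩ := h
  exact ⟨fun y => f (p y), fun y => g (p y), fun γ _ _ h v => hf γ _ v, fun γ _ _ h v => hg γ _ v,
    fun y => he (p y)⟩

theorem isSES_pushforward [Finite Y] (p : Y →[Γ] X) (L M N : EquivariantBundle k Γ Y)
    (h : IsSES L M N) : IsSES (pushforward p L) (pushforward p M) (pushforward p N) := by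
  obtain ⟨f, g, hf, hg, he⟩ := h
  refine ⟨fun x => LinearMap.pi fun y => f y.1 ∘ₗ LinearMap.proj y,
    fun x => LinearMap.pi fun y => g y.1 ∘ₗ LinearMap.proj y,
    fun γ _ _ h v => ?_, fun γ _ _ h v => ?_, fun x => ⟨?_, ?_, ?_⟩⟩
  · funext y
    exact hf γ _ _
  · funext y
    exact hg γ _ _
  · intro v w hvw
    funext y
    exact (he y.1).1 (congrFun hvw y)
  · intro v
    constructor
    · intro hv
      have h1 : ∀ y : {y : Y // p y = x}, ∃ w, f y.1 w = v y :=
        fun y => ((he y.1).2.1 (v y)).1 (congrFun hv y)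
      choose w hw using h1
      exact ⟨w, funext hw⟩
    · rintro ⟨w, rfl⟩
      funext y
      exact ((he y.1).2.1 _).2 ⟨w y, rfl⟩
  · intro v
    choose w hw using fun y : {y : Y // p y = x} => (he y.1).2.2 (v y)
    exact ⟨w, funext hw⟩

end EquivariantBundle

/-- `K([X/Γ]) = K_Γ(X)`: the Grothendieck group of equivariant vector bundles. -/
abbrev EquivariantK (k : Type u) [Field k] (Γ : Type v) [Group Γ] (X : Type v) [MulAction Γ X] :
    Type _ :=
  GrothendieckK (EquivariantBundle k Γ X) EquivariantBundle.IsSES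

/-! The full orbifold `K`-theory of `[pt/G]`

The inertia stack of `[pt/G]` is `[G/G]`, where `G` acts on `G = ∐_{m ∈ G} pt^m` by conjugation,
and the stack of pairs `(m₁, m₂)` is `[G × G/G]`, for simultaneous conjugation. -/

namespace PointStack

variable {G : Type v} [Group G]

/-- The evaluation map `(m₁, m₂) ↦ m₁`. -/
def e₁ : (G × G) →[ConjAct G] G where
  toFun := Prod.fst
  map_smul' _ _ := rfl

/-- The evaluation map `(m₁, m₂) ↦ m₂`. -/
def e₂ : (G × G) →[ConjAct G] G where
  toFun := Prod.snd
  map_smul' _ _ := rfl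

/-- The evaluation map `(m₁, m₂) ↦ m₃⁻¹ = m₁ m₂`, where `m₁ m₂ m₃ = 1`. -/
def e₃ : (G × G) →[ConjAct G] G where
  toFun m := m.1 * m.2
  map_smul' g m := (smul_mul' g m.1 m.2).symm

/-- The inclusion of the untwisted sector. -/
def untwisted : PUnit.{v + 1} →[ConjAct G] G where
  toFun _ := 1
  map_smul' g _ := (smul_one g).symm

end PointStack

/-- `K_full([pt/G])`, the `K`-theory of the inertia stack of `[pt/G]`. -/
def KFull (k : Type u) [Field k] (G : Type v) [Group G] : Type (max (u + 1) (v + 1)) :=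
  EquivariantK k (ConjAct G) G

namespace KFull

variable {k : Type u} [Field k] {G : Type v} [Group G]

instance : AddCommGroup (KFull k G) := inferInstanceAs (AddCommGroup (EquivariantK k (ConjAct G) G))

/-- The class of a vector bundle on the inertia stack. -/
def cls (E : EquivariantBundle k (ConjAct G) G) : KFull k G :=
  GrothendieckK.cls EquivariantBundle.IsSES E

variable [Finite G]

/-- The stringy push-pull product of bundles, `(E, F) ↦ e₃_* (e₁^* E ⊗ e₂^* F)`. The tangent
bundle of a point is zero, so the obstruction bundle is zero and its Euler class is `1`. -/
def stringyProduct (E F : EquivariantBundle k (ConjAct G) G) : EquivariantBundle k (ConjAct G) G :=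
  EquivariantBundle.pushforward PointStack.e₃
    (EquivariantBundle.tensor (EquivariantBundle.pullback PointStack.e₁ E)
      (EquivariantBundle.pullback PointStack.e₂ F))

/-- The product of `K_full([pt/G])`, induced by the push-pull product of bundles. -/
def mulHom : KFull k G →+ KFull k G →+ KFull k G :=
  GrothendieckK.lift₂ stringyProduct
    (fun _ _ _ _ h => EquivariantBundle.isSES_pushforward _ _ _ _
      (EquivariantBundle.isSES_tensor_left _ _ _ _ (EquivariantBundle.isSES_pullback _ _ _ _ h)))
    (fun _ _ _ _ h => EquivariantBundle.isSES_pushforward _ _ _ _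
      (EquivariantBundle.isSES_tensor_right _ _ _ _ (EquivariantBundle.isSES_pullback _ _ _ _ h)))

instance : NonUnitalNonAssocRing (KFull k G) :=
  { (inferInstance : AddCommGroup (KFull k G)) with
    mul := fun x y => mulHom x y
    left_distrib := fun x y z => map_add (mulHom x) y z
    right_distrib := fun x y z => DFunLike.congr_fun (map_add mulHom x y) z
    zero_mul := fun x => DFunLike.congr_fun (map_zero mulHom) x
    mul_zero := fun x => map_zero (mulHom x) }

/-- The unit: the trivial line bundle on the untwisted sector. -/
instance : One (KFull k G) :=
  ⟨cls (EquivariantBundle.pushforward PointStack.untwisted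
    (EquivariantBundle.trivial k (ConjAct G) PUnit.{v + 1}))⟩

theorem cls_mul_cls (E F : EquivariantBundle k (ConjAct G) G) :
    cls E * cls F = cls (stringyProduct E F) := GrothendieckK.lift₂_cls _ _ _ _ _

end KFull

/-- For `g : G`, the fibre at `g` of a vector bundle on the inertia stack is a representation of
the centralizer `Z(g)`. -/
def EquivariantBundle.sectorRep {k : Type u} [Field k] {G : Type v} [Group G]
    (E : EquivariantBundle k (ConjAct G) G) (g : G) :
    Representation k (Subgroup.centralizer ({g} : Set G)) (E.fib g) :=
  have h : ∀ z : Subgroup.centralizer ({g} : Set G), ConjAct.toConjAct (z : G) • g = g := by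
    intro z
    rw [ConjAct.toConjAct_smul, Subgroup.mem_centralizer_singleton_iff.1 z.2, mul_inv_cancel_right]
  { toFun := fun z => E.act (ConjAct.toConjAct (z : G)) (h z)
    map_one' := E.act_one g
    map_mul' := fun z z' => E.act_mul _ _ (h z') (h z) }

end

/-!
A module over `D(k[G])` is graded by `G` through the orthogonal idempotents `(g, e)`, which sum to
`1`, and the elements `∑ g, (g, x)` act on it by translations which conjugate the degrees. This is
the same datum as an equivariant bundle on `G` under conjugation: the components of the module are
the fibres of the bundle, and the module is recovered as the space of global sections. Global
sections of the stringy product are the tensor product of the global sections, regrouped along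
`(m₁, m₂) ↦ m₁ * m₂`, and this is exactly how the comultiplication of `D(k[G])` grades a tensor
product.

For the additive decomposition, a bundle is the product of its restrictions to the orbits, and the
restriction to an orbit is induced from the stabilizer representation on one of its fibres. So the
fibre and induction functors exhibit the `K`-group as a biproduct; under conjugation the stabilizer
of `g` is its centralizer.
-/

noncomputable section

section Products

theorem exact_piMap {ι R : Type*} [Semiring R] {L M N : ι → Type*}
    [∀ i, AddCommMonoid (L i)] [∀ i, Module R (L i)] [∀ i, AddCommMonoid (M i)]
    [∀ i, Module R (M i)] [∀ i, AddCommMonoid (N i)] [∀ i, Module R (N i)]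
    {f : ∀ i, L i →ₗ[R] M i} {g : ∀ i, M i →ₗ[R] N i} (h : ∀ i, Function.Exact (f i) (g i)) :
    Function.Exact (LinearMap.piMap f) (LinearMap.piMap g) := by
  intro s
  simp only [LinearMap.coe_piMap, funext_iff, Pi.map_apply, Pi.zero_apply, Set.mem_range,
    fun i => h i (s i), Classical.skolem]

theorem exact_single_none {ι R : Type*} [DecidableEq ι] [Semiring R] (V : Option ι → Type*)
    [∀ o, AddCommMonoid (V o)] [∀ o, Module R (V o)] :
    Function.Exact (LinearMap.single R V none)
      (LinearMap.pi fun i => LinearMap.proj (R := R) (φ := V) (some i)) := by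
  refine fun s => ⟨fun hs => ⟨s none, funext fun o => ?_⟩, ?_⟩
  · cases o with
    | none => simp
    | some i => simpa using (congrFun hs i).symm
  · rintro ⟨v, rfl⟩
    exact funext fun i => by simp

/-- The tensor product of two finite products, as the product over pairs of indices. -/
def tensorPiEquiv {ι κ R : Type*} [Fintype ι] [DecidableEq ι] [Fintype κ] [DecidableEq κ]
    [CommSemiring R] (V : ι → Type*) (W : κ → Type*) [∀ i, AddCommMonoid (V i)]
    [∀ i, Module R (V i)] [∀ j, AddCommMonoid (W j)] [∀ j, Module R (W j)] :
    (∀ i, V i) ⊗[R] (∀ j, W j) ≃ₗ[R] ∀ p : ι × κ, V p.1 ⊗[R] W p.2 :=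
  (TensorProduct.piLeft R (∀ j, W j) V ≪≫ₗ
      LinearEquiv.piCongrRight fun i => TensorProduct.piRight R R (V i) W) ≪≫ₗ
    { toFun := fun t p => t p.1 p.2
      invFun := fun t i j => t (i, j)
      map_add' := fun _ _ => rfl
      map_smul' := fun _ _ => rfl
      left_inv := fun _ => rfl
      right_inv := fun _ => rfl }

@[simp]
theorem tensorPiEquiv_tmul {ι κ R : Type*} [Fintype ι] [DecidableEq ι] [Fintype κ]
    [DecidableEq κ] [CommSemiring R] {V : ι → Type*} {W : κ → Type*} [∀ i, AddCommMonoid (V i)]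
    [∀ i, Module R (V i)] [∀ j, AddCommMonoid (W j)] [∀ j, Module R (W j)]
    (s : ∀ i, V i) (t : ∀ j, W j) (p : ι × κ) :
    tensorPiEquiv (R := R) V W (s ⊗ₜ t) p = s p.1 ⊗ₜ t p.2 := by
  simp [tensorPiEquiv]

/-- A section of a family over `Y`, sorted by the fibres of `f : Y → X`. -/
def sectionsByFibre {X Y : Type*} (R : Type*) [Semiring R] (f : Y → X) (V : Y → Type*)
    [∀ y, AddCommMonoid (V y)] [∀ y, Module R (V y)] :
    (∀ y, V y) ≃ₗ[R] ∀ x, ∀ y : {y // f y = x}, V y where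
  toFun s _ y := s y
  invFun s y := s (f y) ⟨y, rfl⟩
  map_add' _ _ := rfl
  map_smul' _ _ := rfl
  left_inv _ := rfl
  right_inv s := by
    funext x ⟨y, hy⟩
    subst hy
    rfl

/-- Homomorphisms `s i : A → B i` and `j i : B i → A` exhibiting `A` as the biproduct of the `B i`
identify `A` with the product of the `B i`. -/
def addEquivPiOfBiproduct {ι A : Type*} {B : ι → Type*} [Fintype ι] [AddCommMonoid A]
    [∀ i, AddCommMonoid (B i)] (s : ∀ i, A →+ B i) (j : ∀ i, B i →+ A)
    (hself : ∀ i, (s i).comp (j i) = AddMonoidHom.id (B i))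
    (hne : ∀ i l, i ≠ l → (s i).comp (j l) = 0)
    (hsum : ∑ i, (j i).comp (s i) = AddMonoidHom.id A) : A ≃+ ∀ i, B i :=
  AddMonoidHom.toAddEquiv (AddMonoidHom.pi s) (∑ i, (j i).comp (Pi.evalAddMonoidHom B i))
    (by
      refine .trans (AddMonoidHom.ext fun a => ?_) hsum
      simp)
    (AddMonoidHom.ext fun b => funext fun i => by
      have hi : s i (j i (b i)) = b i := DFunLike.congr_fun (hself i) (b i)
      have hl (l : ι) (h : l ≠ i) : s i (j l (b l)) = 0 :=
        DFunLike.congr_fun (hne i l h.symm) (b l)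
      simpa [hi] using Finset.sum_eq_single i (fun l _ => hl l) (by simp))

end Products

namespace GrothendieckK

universe w'

variable {T : Type w} {SES : T → T → T → Prop} {T' : Type w'} {SES' : T' → T' → T' → Prop}

theorem cls_eq_zero {Z : T} (h : SES Z Z Z) : cls SES Z = 0 := by
  simpa using cls_eq_add h

theorem cls_eq_cls {M N Z : T} (hZ : SES Z Z Z) (h : SES M N Z) : cls SES M = cls SES N := by
  rw [cls_eq_add h, cls_eq_zero hZ, add_zero]

/-- An exact operation on objects induces a homomorphism of Grothendieck groups. -/
def map (F : T → T') (hF : ∀ A B C, SES A B C → SES' (F A) (F B) (F C)) :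
    GrothendieckK T SES →+ GrothendieckK T' SES' :=
  lift (fun A => cls SES' (F A)) fun A B C h => cls_eq_add (hF A B C h)

@[simp]
theorem map_cls (F : T → T') (hF : ∀ A B C, SES A B C → SES' (F A) (F B) (F C)) (A : T) :
    map F hF (cls SES A) = cls SES' (F A) :=
  lift_cls _ _ _

/-- Exact operations which are mutually inverse on classes induce an isomorphism of Grothendieck
groups. -/
def congr (F : T → T') (G : T' → T)
    (hF : ∀ A B C, SES A B C → SES' (F A) (F B) (F C))
    (hG : ∀ A B C, SES' A B C → SES (G A) (G B) (G C))
    (hGF : ∀ A, cls SES (G (F A)) = cls SES A) (hFG : ∀ B, cls SES' (F (G B)) = cls SES' B) :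
    GrothendieckK T SES ≃+ GrothendieckK T' SES' :=
  AddMonoidHom.toAddEquiv (map F hF) (map G hG) (hom_ext fun A => by simp [hGF])
    (hom_ext fun B => by simp [hFG])

@[simp]
theorem congr_cls (F : T → T') (G : T' → T)
    (hF : ∀ A B C, SES A B C → SES' (F A) (F B) (F C))
    (hG : ∀ A B C, SES' A B C → SES (G A) (G B) (G C))
    (hGF : ∀ A, cls SES (G (F A)) = cls SES A) (hFG : ∀ B, cls SES' (F (G B)) = cls SES' B)
    (A : T) : congr F G hF hG hGF hFG (cls SES A) = cls SES' (F A) :=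
  map_cls F hF A

end GrothendieckK

section Intertwines

variable {k : Type u} [Field k] {A : Type v} [Ring A] [Algebra k A] {V W : Type*}
  [AddCommGroup V] [Module k V] [AddCommGroup W] [Module k W]

/-- The linear map `f` is a morphism between the `A`-modules `(ρ, V)` and `(σ, W)`. -/
def Intertwines (ρ : A →ₐ[k] Module.End k V) (σ : A →ₐ[k] Module.End k W) (f : V →ₗ[k] W) : Prop :=
  ∀ a v, f (ρ a v) = σ a (f v)

variable {ρ : A →ₐ[k] Module.End k V} {σ : A →ₐ[k] Module.End k W} {f : V →ₗ[k] W}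

theorem intertwines_of_span_eq_top {S : Set A} (hS : Submodule.span k S = ⊤)
    (h : ∀ a ∈ S, ∀ v, f (ρ a v) = σ a (f v)) : Intertwines ρ σ f := by
  have hSf : Submodule.span k S ≤ LinearMap.eqLocus
      (LinearMap.compRight k f ∘ₗ ρ.toLinearMap) (LinearMap.lcomp k W f ∘ₗ σ.toLinearMap) :=
    Submodule.span_le.2 fun a ha => LinearMap.ext (h a ha)
  exact fun a => DFunLike.congr_fun (hSf (hS ▸ Submodule.mem_top : a ∈ Submodule.span k S))

end Intertwines

namespace EquivariantBundle

variable {k : Type u} [Field k] {Γ : Type v} [Group Γ] {X : Type v} [MulAction Γ X]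

/-- The class of an equivariant bundle in `K([X/Γ])`. -/
abbrev cls (E : EquivariantBundle k Γ X) : EquivariantK k Γ X :=
  GrothendieckK.cls IsSES E

/-- The family of linear maps `f` is a morphism of equivariant bundles. -/
def IsHom {E F : EquivariantBundle k Γ X} (f : ∀ x, E.fib x →ₗ[k] F.fib x) : Prop :=
  ∀ (γ : Γ) {x y : X} (h : γ • x = y) (v : E.fib x), f y (E.act γ h v) = F.act γ h (f x v)

theorem isSES_self {Z : EquivariantBundle k Γ X} (hZ : ∀ x, Subsingleton (Z.fib x)) :
    IsSES Z Z Z :=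
  ⟨fun _ => LinearMap.id, fun _ => LinearMap.id, fun _ _ _ _ _ => rfl, fun _ _ _ _ _ => rfl,
    fun _ => ⟨Function.injective_id, fun v => by simp [Subsingleton.elim v 0],
      Function.surjective_id⟩⟩

theorem cls_zero {Z : EquivariantBundle k Γ X} (hZ : ∀ x, Subsingleton (Z.fib x)) : Z.cls = 0 :=
  GrothendieckK.cls_eq_zero (isSES_self hZ)

theorem cls_congr {E F : EquivariantBundle k Γ X} (e : ∀ x, E.fib x ≃ₗ[k] F.fib x)
    (he : IsHom fun x => (e x : E.fib x →ₗ[k] F.fib x)) : E.cls = F.cls := by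
  let Z : EquivariantBundle k Γ X :=
    { fib := fun _ => PUnit
      act := fun _ _ _ _ => LinearMap.id
      act_one := fun _ => rfl
      act_mul := fun _ _ _ _ _ _ _ => rfl }
  have hZ : ∀ x, Subsingleton (Z.fib x) := fun _ => inferInstanceAs (Subsingleton PUnit)
  exact GrothendieckK.cls_eq_cls (isSES_self hZ)
    ⟨fun x => (e x : E.fib x →ₗ[k] F.fib x), fun _ => 0, he, fun _ _ _ _ _ => rfl,
      fun x => ⟨(e x).injective, fun v => by simp, fun v => ⟨0, Subsingleton.elim _ v⟩⟩⟩

theorem act_act (E : EquivariantBundle k Γ X) {a b c : Γ} (hc : a * b = c) {x y z : X}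
    (hx : b • x = y) (hy : a • y = z) (hz : c • x = z) (v : E.fib x) :
    E.act a hy (E.act b hx v) = E.act c hz v := by
  subst hc
  exact (DFunLike.congr_fun (E.act_mul a b hx hy) v).symm

theorem act_eq_self (E : EquivariantBundle k Γ X) {a : Γ} (ha : a = 1) {x : X} (h : a • x = x)
    (v : E.fib x) : E.act a h v = v := by
  subst ha
  exact DFunLike.congr_fun (E.act_one x) v

/-- The representation of `Γ` on the global sections of an equivariant bundle. -/
def translation (E : EquivariantBundle k Γ X) : Representation k Γ (∀ x, E.fib x) where
  toFun γ := LinearMap.pi fun y => E.act γ (smul_inv_smul γ y) ∘ₗ LinearMap.proj (γ⁻¹ • y)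
  map_one' := by
    have key (s : ∀ x, E.fib x) {x y : X} (h : (1 : Γ) • x = y) : E.act 1 h (s x) = s y := by
      obtain rfl : x = y := by rw [← h, one_smul]
      exact E.act_eq_self rfl h _
    exact LinearMap.ext fun s => funext fun y => key s _
  map_mul' γ δ := by
    have key (s : ∀ x, E.fib x) {x x' y z : X} (h : (γ * δ) • x = z) (h' : δ • x' = y)
        (hy : γ • y = z) : E.act (γ * δ) h (s x) = E.act γ hy (E.act δ h' (s x')) := by
      obtain rfl : x = x' := by
        rw [mul_smul, ← hy, ← h'] at h
        exact smul_left_cancel _ (smul_left_cancel _ h)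
      exact (E.act_act rfl h' hy h _).symm
    exact LinearMap.ext fun s => funext fun z => key s _ _ _

theorem translation_apply (E : EquivariantBundle k Γ X) {γ : Γ} {x y : X} (h : γ • x = y)
    (s : ∀ x, E.fib x) : E.translation γ s y = E.act γ h (s x) := by
  obtain rfl : x = γ⁻¹ • y := by rw [← h, inv_smul_smul]
  rfl

/-- The projection of global sections onto the sections supported at `x`. -/
def fibreProj [DecidableEq X] (E : EquivariantBundle k Γ X) (x : X) :
    Module.End k (∀ x, E.fib x) :=
  LinearMap.single k E.fib x ∘ₗ LinearMap.proj x

theorem fibreProj_apply [DecidableEq X] (E : EquivariantBundle k Γ X) (x : X) (s : ∀ x, E.fib x)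
    (y : X) : E.fibreProj x s y = if x = y then s y else 0 := by
  obtain rfl | h := eq_or_ne x y
  · simp [fibreProj]
  · simp [fibreProj, h]

theorem completeOrthogonalIdempotents_fibreProj [Fintype X] [DecidableEq X]
    (E : EquivariantBundle k Γ X) : CompleteOrthogonalIdempotents E.fibreProj where
  idem x := LinearMap.ext fun s => funext fun y => by
    simp +contextual [fibreProj_apply]
  ortho x x' h := LinearMap.ext fun s => funext fun y => by
    obtain rfl | hx := eq_or_ne x y
    · simp [fibreProj_apply, h.symm]
    · simp [fibreProj_apply, hx]
  complete := LinearMap.ext fun s => funext fun y => by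
    simp [LinearMap.sum_apply, Finset.sum_apply, fibreProj_apply]

theorem translation_mul_fibreProj [DecidableEq X] (E : EquivariantBundle k Γ X) (γ : Γ) (x : X) :
    E.translation γ * E.fibreProj x = E.fibreProj (γ • x) * E.translation γ := by
  refine LinearMap.ext fun s => funext fun y => ?_
  have hy := smul_inv_smul γ y
  simp only [Module.End.mul_apply, fibreProj_apply, E.translation_apply hy, smul_eq_iff_eq_inv_smul]
  split_ifs
  · rfl
  · exact map_zero _

end EquivariantBundle

namespace DrinfeldDouble

theorem intertwines_of_elt {k : Type u} [Field k] {G : Type v} [Group G] [Fintype G]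
    [DecidableEq G] {V W : Type*} [AddCommGroup V] [Module k V] [AddCommGroup W] [Module k W]
    {ρ : DrinfeldDouble k G →ₐ[k] Module.End k V} {σ : DrinfeldDouble k G →ₐ[k] Module.End k W}
    {f : V →ₗ[k] W} (h : ∀ g x v, f (ρ (elt k g x) v) = σ (elt k g x) (f v)) :
    Intertwines ρ σ f :=
  intertwines_of_span_eq_top (basis k G).span_eq (by rintro _ ⟨p, rfl⟩; exact h p.1 p.2)

variable {k : Type u} [Field k] {G : Type v} [Group G] [Fintype G] [DecidableEq G]
  {B : Type*} [Ring B] [Algebra k B]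

/-- The universal property of the Drinfel'd double: a morphism out of it amounts to a covariant
system, that is, a complete family of orthogonal idempotents `P` permuted by the units `T x`
according to conjugation. -/
def liftCovariant (P : G → B) (T : G →* B) (hP : CompleteOrthogonalIdempotents P)
    (hPT : ∀ x h, T x * P h = P (x * h * x⁻¹) * T x) : DrinfeldDouble k G →ₐ[k] B :=
  have hf (g x : G) : (basis k G).constr k (fun p => P p.1 * T p.2) (elt k g x) = P g * T x :=
    (basis k G).constr_basis k _ (g, x)
  algHomOfBasis ((basis k G).constr k fun p => P p.1 * T p.2)
    (by simp [one_def, hf, hP.complete])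
    (by
      intro g x h y
      have hmul : P g * T x * (P h * T y) = P g * P (x * h * x⁻¹) * T (x * y) := by
        rw [mul_assoc, ← mul_assoc (T x), hPT, map_mul]
        simp only [mul_assoc]
      rw [elt_mul_elt, apply_ite ((basis k G).constr k _), map_zero, hf, hf, hf, hmul, hP.mul_eq,
        ite_mul, zero_mul])

theorem liftCovariant_elt (P : G → B) (T : G →* B) (hP : CompleteOrthogonalIdempotents P)
    (hPT : ∀ x h, T x * P h = P (x * h * x⁻¹) * T x) (g x : G) :
    liftCovariant (k := k) P T hP hPT (elt k g x) = P g * T x :=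
  (basis k G).constr_basis k _ (g, x)

end DrinfeldDouble

/-! ### Bundles on the inertia stack and modules over the Drinfel'd double -/

namespace EquivariantBundle

variable {k : Type u} [Field k] {G : Type v} [Group G] [Fintype G] [DecidableEq G]
  (E : EquivariantBundle k (ConjAct G) G)

/-- The action of `D(k[G])` on the global sections of a bundle on the inertia stack: the basis
element `(g, x)` translates a section by `x` and then restricts it to the fibre at `g`. -/
def sectionsRep : DrinfeldDouble k G →ₐ[k] Module.End k (∀ g, E.fib g) :=
  DrinfeldDouble.liftCovariant E.fibreProj (E.translation.comp ConjAct.toConjAct.toMonoidHom)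
    E.completeOrthogonalIdempotents_fibreProj
    fun x g => E.translation_mul_fibreProj (ConjAct.toConjAct x) g

theorem sectionsRep_elt (g x : G) :
    E.sectionsRep (.elt k g x) = E.fibreProj g * E.translation (ConjAct.toConjAct x) :=
  DrinfeldDouble.liftCovariant_elt _ _ _ _ g x

theorem sectionsRep_elt_apply {g x y z : G} (h : ConjAct.toConjAct x • y = z) (s : ∀ g, E.fib g) :
    E.sectionsRep (.elt k g x) s z = if g = z then E.act _ h (s y) else 0 := by
  rw [sectionsRep_elt, Module.End.mul_apply, fibreProj_apply, E.translation_apply h]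

/-- The `D(k[G])`-module of global sections of a bundle on the inertia stack. -/
def toModule : FDModule k (DrinfeldDouble k G) where
  V := ∀ g, E.fib g
  ρ := E.sectionsRep

variable {E} in
theorem IsHom.intertwines {F : EquivariantBundle k (ConjAct G) G}
    {f : ∀ g, E.fib g →ₗ[k] F.fib g} (hf : IsHom f) :
    Intertwines E.sectionsRep F.sectionsRep (LinearMap.piMap f) :=
  DrinfeldDouble.intertwines_of_elt fun g x s => funext fun z => by
    have hz := smul_inv_smul (ConjAct.toConjAct x) z
    simp only [LinearMap.coe_piMap, Pi.map_apply, E.sectionsRep_elt_apply hz,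
      F.sectionsRep_elt_apply hz, apply_ite (f z), hf _ hz, map_zero]

theorem isSES_toModule (L M N : EquivariantBundle k (ConjAct G) G) (h : IsSES L M N) :
    FDModule.IsSES L.toModule M.toModule N.toModule := by
  obtain ⟨f, g, hf, hg, he⟩ := h
  exact ⟨LinearMap.piMap f, LinearMap.piMap g, IsHom.intertwines hf, IsHom.intertwines hg,
    Function.Injective.piMap fun x => (he x).1, exact_piMap fun x => (he x).2.1,
    Function.Surjective.piMap fun x => (he x).2.2⟩

end EquivariantBundle

namespace DrinfeldDouble

variable {k : Type u} [Field k] {G : Type v} [Group G] [Fintype G] [DecidableEq G]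
  {V W U : Type*} [AddCommGroup V] [Module k V] [AddCommGroup W] [Module k W]
  [AddCommGroup U] [Module k U]
  (ρ : DrinfeldDouble k G →ₐ[k] Module.End k V) {σ : DrinfeldDouble k G →ₐ[k] Module.End k W}
  {τ : DrinfeldDouble k G →ₐ[k] Module.End k U}

/-- The component of degree `g` of a `D(k[G])`-module: the image of the idempotent `(g, e)`. -/
def component (g : G) : Submodule k V :=
  LinearMap.range (ρ (elt k g 1))

theorem elt_apply_elt (g x h y : G) (v : V) : ρ (elt k g x) (ρ (elt k h y) v) =
    if g = x * h * x⁻¹ then ρ (elt k g (x * y)) v else 0 := by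
  rw [← Module.End.mul_apply, ← map_mul, elt_mul_elt]
  split_ifs <;> simp

theorem elt_mem_component (g x : G) (v : V) : ρ (elt k g x) v ∈ component ρ g :=
  ⟨ρ (elt k g x) v, by simp [elt_apply_elt]⟩

variable {ρ}

theorem mem_component_iff {g : G} {v : V} : v ∈ component ρ g ↔ ρ (elt k g 1) v = v :=
  ⟨by rintro ⟨w, rfl⟩; simp [elt_apply_elt], fun h => ⟨v, h⟩⟩

theorem elt_one_apply_of_mem {g h : G} {v : V} (hv : v ∈ component ρ h) :
    ρ (elt k g 1) v = if g = h then v else 0 := by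
  obtain ⟨w, rfl⟩ := hv
  rw [elt_apply_elt, one_mul, one_mul, inv_one, mul_one]
  split_ifs with hgh
  · rw [hgh]
  · rfl

/-- A `D(k[G])`-module is the product of its components. -/
def componentEquiv (ρ : DrinfeldDouble k G →ₐ[k] Module.End k V) :
    V ≃ₗ[k] ∀ g, component ρ g where
  toFun v g := ⟨ρ (elt k g 1) v, elt_mem_component ρ g 1 v⟩
  invFun s := ∑ g, (s g : V)
  map_add' v w := funext fun g => Subtype.ext (map_add _ v w)
  map_smul' c v := funext fun g => Subtype.ext (map_smul _ c v)
  left_inv v := by simpa [one_def] using DFunLike.congr_fun (map_one ρ) v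
  right_inv s := funext fun g => Subtype.ext <| by
    simp [elt_one_apply_of_mem (s _).2]

/-- The restriction of a morphism of `D(k[G])`-modules to the components of degree `g`. -/
def componentMap {f : V →ₗ[k] W} (hf : Intertwines ρ σ f) (g : G) :
    component ρ g →ₗ[k] component σ g :=
  f.restrict fun v hv => by rw [mem_component_iff, ← hf, mem_component_iff.1 hv]

theorem componentMap_surjective {f : V →ₗ[k] W} (hf : Intertwines ρ σ f)
    (hsurj : Function.Surjective f) (g : G) : Function.Surjective (componentMap hf g) := by
  rintro ⟨w, hw⟩
  obtain ⟨v, rfl⟩ := hsurj w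
  exact ⟨⟨_, elt_mem_component ρ g 1 v⟩, Subtype.ext ((hf _ v).trans (mem_component_iff.1 hw))⟩

theorem componentMap_exact {f : V →ₗ[k] W} {f' : W →ₗ[k] U} (hf : Intertwines ρ σ f)
    (hf' : Intertwines σ τ f') (hexact : Function.Exact f f') (g : G) :
    Function.Exact (componentMap hf g) (componentMap hf' g) := by
  rintro ⟨v, hv⟩
  constructor
  · intro h
    obtain ⟨w, rfl⟩ := (hexact v).1 (congrArg Subtype.val h)
    exact ⟨⟨_, elt_mem_component ρ g 1 w⟩, Subtype.ext ((hf _ w).trans (mem_component_iff.1 hv))⟩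
  · rintro ⟨w, hw⟩
    exact Subtype.ext ((hexact v).2 ⟨w, congrArg Subtype.val hw⟩)

end DrinfeldDouble

namespace FDModule

open DrinfeldDouble

variable {k : Type u} [Field k] {G : Type v} [Group G] [Fintype G] [DecidableEq G]

/-- The bundle on the inertia stack whose fibre at `g` is the component of degree `g`. -/
def toBundle (M : FDModule k (DrinfeldDouble k G)) : EquivariantBundle k (ConjAct G) G where
  fib g := component M.ρ g
  act γ _ y _ := (M.ρ (elt k y (ConjAct.ofConjAct γ))).restrict
    fun v _ => elt_mem_component M.ρ y _ v
  act_one g := LinearMap.ext fun v => Subtype.ext (mem_component_iff.1 v.2)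
  act_mul γ δ _ y z _ hy := LinearMap.ext fun v => Subtype.ext <| by
    change M.ρ (elt k z (ConjAct.ofConjAct γ * ConjAct.ofConjAct δ)) v = M.ρ _ (M.ρ _ v)
    rw [elt_apply_elt, if_pos (hy.symm.trans (ConjAct.smul_def γ y))]

theorem isSES_toBundle (L M N : FDModule k (DrinfeldDouble k G)) (h : IsSES L M N) :
    EquivariantBundle.IsSES L.toBundle M.toBundle N.toBundle := by
  obtain ⟨f, g, hf, hg, hinj, hexact, hsurj⟩ := h
  exact ⟨componentMap hf, componentMap hg, fun _ _ _ _ v => Subtype.ext (hf _ v.1),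
    fun _ _ _ _ v => Subtype.ext (hg _ v.1), fun x =>
      ⟨fun v w hvw => Subtype.ext (hinj (congrArg Subtype.val hvw)),
        componentMap_exact hf hg hexact x, componentMap_surjective hg hsurj x⟩⟩

theorem intertwines_componentEquiv (M : FDModule k (DrinfeldDouble k G)) :
    Intertwines M.ρ M.toBundle.sectionsRep (componentEquiv M.ρ).toLinearMap := by
  refine intertwines_of_elt fun g x v => funext fun z => Subtype.ext ?_
  have hz := smul_inv_smul (ConjAct.toConjAct x) z
  rw [M.toBundle.sectionsRep_elt_apply hz]
  change M.ρ (elt k z 1) (M.ρ (elt k g x) v) = _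
  rw [elt_one_apply_of_mem (elt_mem_component M.ρ g x v)]
  obtain rfl | hgz := eq_or_ne g z
  · rw [if_pos rfl, if_pos rfl]
    change _ = M.ρ (elt k g x) (M.ρ (elt k _ 1) v)
    rw [elt_apply_elt, mul_one, if_pos]
    exact hz.symm.trans (ConjAct.smul_def _ _)
  · rw [if_neg hgz, if_neg hgz.symm]
    rfl

theorem cls_toModule_toBundle (M : FDModule k (DrinfeldDouble k G)) :
    RepRing.cls M.toBundle.toModule = RepRing.cls M :=
  (cls_congr (N := M.toBundle.toModule) (componentEquiv M.ρ) M.intertwines_componentEquiv).symm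

end FDModule

namespace EquivariantBundle

variable {k : Type u} [Field k] {G : Type v} [Group G] [Fintype G] [DecidableEq G]
  (E : EquivariantBundle k (ConjAct G) G)

variable {E} in
theorem mem_component_sectionsRep_iff {g : G} {s : ∀ g, E.fib g} :
    s ∈ DrinfeldDouble.component E.sectionsRep g ↔ E.fibreProj g s = s := by
  rw [DrinfeldDouble.mem_component_iff, sectionsRep_elt, map_one, map_one, mul_one]

/-- Sections supported at `g` are determined by their value at `g`. -/
def componentSectionsEquiv (g : G) :
    DrinfeldDouble.component E.sectionsRep g ≃ₗ[k] E.fib g where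
  toFun s := s.1 g
  invFun v := ⟨Pi.single g v, mem_component_sectionsRep_iff.2 (by simp [fibreProj])⟩
  map_add' _ _ := rfl
  map_smul' _ _ := rfl
  left_inv s := Subtype.ext (mem_component_sectionsRep_iff.1 s.2)
  right_inv v := Pi.single_eq_same g v

theorem cls_toBundle_toModule : E.toModule.toBundle.cls = E.cls :=
  cls_congr (E := E.toModule.toBundle) E.componentSectionsEquiv fun γ _ _ h s =>
    (E.sectionsRep_elt_apply (x := ConjAct.ofConjAct γ) h s.1).trans (if_pos rfl)

end EquivariantBundle

/-! ### The stringy product -/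

section StringyProduct

variable {k : Type u} [Field k] {G : Type v} [Group G] [Fintype G] [DecidableEq G]

namespace EquivariantBundle

/-- The tensor product of the sections of `E` and `F`, as the sections of the stringy product. -/
def sectionsTensorEquiv (E F : EquivariantBundle k (ConjAct G) G) :
    (∀ g, E.fib g) ⊗[k] (∀ g, F.fib g) ≃ₗ[k] ∀ g, (KFull.stringyProduct E F).fib g :=
  tensorPiEquiv E.fib F.fib ≪≫ₗ
    sectionsByFibre k (fun m : G × G => m.1 * m.2) fun m => E.fib m.1 ⊗[k] F.fib m.2

theorem tensorRep_sectionsRep_tmul (E F : EquivariantBundle k (ConjAct G) G) (g x a b : G)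
    (s : ∀ g, E.fib g) (t : ∀ g, F.fib g) :
    tensorPiEquiv E.fib F.fib
        (tensorRep E.sectionsRep F.sectionsRep (.elt k g x) (s ⊗ₜ t)) (a, b) =
      if a * b = g then
        E.translation (ConjAct.toConjAct x) s a ⊗ₜ F.translation (ConjAct.toConjAct x) t b
      else 0 := by
  -- Of the summands of the comultiplication of `(g, x)`, only `(a, b)` is seen by the fibre there.
  have hproj (q : G × G) :
      E.fibreProj q.1 (E.translation (ConjAct.toConjAct x) s) a ⊗ₜ[k]
          F.fibreProj q.2 (F.translation (ConjAct.toConjAct x) t) b =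
        if q = (a, b) then
          E.translation (ConjAct.toConjAct x) s a ⊗ₜ F.translation (ConjAct.toConjAct x) t b
        else 0 := by
    rw [fibreProj_apply, fibreProj_apply, TensorProduct.ite_tmul, TensorProduct.tmul_ite, ← ite_and]
    simp only [Prod.ext_iff]
  simp only [tensorRep_apply, DrinfeldDouble.comul_elt, map_sum, outerTensorRep_tmul,
    LinearMap.sum_apply, TensorProduct.map_tmul, Finset.sum_apply, tensorPiEquiv_tmul,
    sectionsRep_elt, Module.End.mul_apply, hproj, Finset.sum_ite_eq', Finset.mem_filter_univ]

theorem intertwines_sectionsTensorEquiv (E F : EquivariantBundle k (ConjAct G) G) :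
    Intertwines (tensorRep E.sectionsRep F.sectionsRep) (KFull.stringyProduct E F).sectionsRep
      (E.sectionsTensorEquiv F).toLinearMap := by
  refine DrinfeldDouble.intertwines_of_elt fun g x t => ?_
  induction t with
  | zero => simp only [map_zero]
  | add t t' ht ht' => simp only [map_add, ht, ht']
  | tmul s t =>
    funext z ⟨⟨a, b⟩, (hab : a * b = z)⟩
    subst hab
    have hz := smul_inv_smul (ConjAct.toConjAct x) (a * b)
    rw [sectionsRep_elt_apply _ hz]
    refine (tensorRep_sectionsRep_tmul E F g x a b s t).trans ?_
    obtain rfl | hg := eq_or_ne (a * b) g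
    · rw [if_pos rfl, if_pos rfl]
      rfl
    · rw [if_neg hg, if_neg hg.symm]
      rfl

theorem cls_toModule_stringyProduct (E F : EquivariantBundle k (ConjAct G) G) :
    RepRing.cls (KFull.stringyProduct E F).toModule =
      RepRing.cls E.toModule * RepRing.cls F.toModule := by
  rw [RepRing.cls_mul_cls]
  exact (FDModule.cls_congr (M := E.toModule.tensor F.toModule)
    (N := (KFull.stringyProduct E F).toModule) (E.sectionsTensorEquiv F)
    (E.intertwines_sectionsTensorEquiv F)).symm

/-- The unit bundle of the stringy product: the trivial line bundle on the untwisted sector. -/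
abbrev untwistedTrivial (k : Type u) [Field k] (G : Type v) [Group G] :
    EquivariantBundle k (ConjAct G) G :=
  pushforward PointStack.untwisted (trivial k (ConjAct G) PUnit)

/-- Sections of the trivial line bundle on the untwisted sector are scalars. -/
def sectionsUntwistedEquiv (k : Type u) [Field k] (G : Type v) [Group G] :
    ULift.{max u v} k ≃ₗ[k] ∀ g, (untwistedTrivial k G).fib g :=
  ULift.moduleEquiv ≪≫ₗ ULift.moduleEquiv.symm ≪≫ₗ
    (LinearEquiv.funUnique PUnit.{v + 1} k (ULift.{v} k)).symm ≪≫ₗ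
    sectionsByFibre k (fun _ => (1 : G)) fun _ => ULift.{v} k

theorem intertwines_sectionsUntwistedEquiv :
    Intertwines (trivialRep k (DrinfeldDouble k G) (ULift.{max u v} k))
      (untwistedTrivial k G).sectionsRep (sectionsUntwistedEquiv k G).toLinearMap := by
  refine DrinfeldDouble.intertwines_of_elt fun g x c => ?_
  funext z ⟨p, (hz : 1 = z)⟩
  subst hz
  have h1 := smul_inv_smul (ConjAct.toConjAct x) (1 : G)
  rw [sectionsRep_elt_apply _ h1]
  have htriv : trivialRep k (DrinfeldDouble k G) (ULift.{max u v} k) (.elt k g x) c =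
      if g = 1 then c else 0 := by
    simp only [trivialRep, AlgHom.comp_apply, Bialgebra.counitAlgHom_apply,
      DrinfeldDouble.counit_elt, Algebra.lsmul_coe, ite_smul, one_smul, zero_smul]
  rw [htriv]
  split_ifs <;> rfl

theorem cls_toModule_untwistedTrivial :
    RepRing.cls (untwistedTrivial k G).toModule = 1 :=
  (FDModule.cls_congr (M := FDModule.trivial k _) (N := (untwistedTrivial k G).toModule)
    (sectionsUntwistedEquiv k G) intertwines_sectionsUntwistedEquiv).symm

end EquivariantBundle

namespace KFull

/-- The identification of full `K`-theory with the representation group of `D(k[G])`, given by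
global sections. -/
def addEquivRepRing : KFull k G ≃+ RepRing k (DrinfeldDouble k G) :=
  GrothendieckK.congr EquivariantBundle.toModule FDModule.toBundle
    EquivariantBundle.isSES_toModule FDModule.isSES_toBundle
    EquivariantBundle.cls_toBundle_toModule FDModule.cls_toModule_toBundle

theorem addEquivRepRing_cls (E : EquivariantBundle k (ConjAct G) G) :
    addEquivRepRing (cls E) = RepRing.cls E.toModule :=
  GrothendieckK.congr_cls ..

theorem addEquivRepRing_mul (a b : KFull k G) :
    addEquivRepRing (a * b) = addEquivRepRing a * addEquivRepRing b := by
  refine (AddMonoidHom.map_mul_iff (addEquivRepRing (k := k) (G := G)).toAddMonoidHom).2 ?_ a b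
  refine GrothendieckK.hom_ext fun E => GrothendieckK.hom_ext fun F => ?_
  have h := E.cls_toModule_stringyProduct F
  rw [← addEquivRepRing_cls, ← addEquivRepRing_cls, ← addEquivRepRing_cls, ← cls_mul_cls] at h
  exact h

/-- Global sections, as an isomorphism of rings from full `K`-theory with its stringy product to the
representation ring of `D(k[G])`. -/
def ringEquivRepRing : KFull k G ≃+* RepRing k (DrinfeldDouble k G) :=
  { addEquivRepRing with map_mul' := addEquivRepRing_mul }

theorem ringEquivRepRing_one : (ringEquivRepRing : KFull k G ≃+* _) 1 = 1 :=
  (addEquivRepRing_cls _).trans EquivariantBundle.cls_toModule_untwistedTrivial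

end KFull

end StringyProduct

/-! ### The orbit decomposition -/

section GroupAlgebra

variable {k : Type u} [Field k] {H : Type v} [Group H] {V W : Type*} [AddCommGroup V] [Module k V]
  [AddCommGroup W] [Module k W]

theorem intertwines_of_of {ρ : MonoidAlgebra k H →ₐ[k] Module.End k V}
    {σ : MonoidAlgebra k H →ₐ[k] Module.End k W} {f : V →ₗ[k] W}
    (h : ∀ γ v, f (ρ (MonoidAlgebra.of k H γ) v) = σ (MonoidAlgebra.of k H γ) (f v)) :
    Intertwines ρ σ f := by
  intro a
  induction a using MonoidAlgebra.induction_on with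
  | of γ => exact h γ
  | add a b ha hb => intro v; simp only [map_add, LinearMap.add_apply, ha, hb]
  | smul c a ha => intro v; simp only [map_smul, LinearMap.smul_apply, ha]

theorem intertwines_asAlgebraHom {ρ : Representation k H V} {σ : Representation k H W}
    {f : V →ₗ[k] W} (h : ∀ γ v, f (ρ γ v) = σ γ (f v)) :
    Intertwines ρ.asAlgebraHom σ.asAlgebraHom f :=
  intertwines_of_of fun γ v => by
    simpa only [Representation.asAlgebraHom_of] using h γ v

end GroupAlgebra

namespace FDModule

/-- The restriction of a module along a morphism of algebras. -/
def comap {k : Type u} [Field k] {A B : Type v} [Ring A] [Algebra k A] [Ring B] [Algebra k B]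
    (f : A →ₐ[k] B) (M : FDModule k B) : FDModule k A where
  V := M.V
  ρ := M.ρ.comp f

theorem isSES_comap {k : Type u} [Field k] {A B : Type v} [Ring A] [Algebra k A] [Ring B]
    [Algebra k B] (f : A →ₐ[k] B) (L M N : FDModule k B) (h : IsSES L M N) :
    IsSES (L.comap f) (M.comap f) (N.comap f) := by
  obtain ⟨i, p, hi, hp, he⟩ := h
  exact ⟨i, p, fun a => hi (f a), fun a => hp (f a), he⟩

theorem cls_comap_comap {k : Type u} [Field k] {A B : Type v} [Ring A] [Algebra k A] [Ring B]
    [Algebra k B] {f : A →ₐ[k] B} {g : B →ₐ[k] A} (h : f.comp g = AlgHom.id k B)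
    (M : FDModule k B) : RepRing.cls ((M.comap f).comap g) = RepRing.cls M :=
  cls_congr (M := (M.comap f).comap g) (LinearEquiv.refl k M.V) fun b v =>
    congrArg (fun b => M.ρ b v) (DFunLike.congr_fun h b)

variable {k : Type u} [Field k] {H : Type v} [Group H]

/-- The representation of `H` underlying a module over `k[H]`. -/
def groupRep (M : FDModule k (MonoidAlgebra k H)) : Representation k H M.V :=
  (M.ρ : MonoidAlgebra k H →* Module.End k M.V).comp (MonoidAlgebra.of k H)

theorem groupRep_ofRepresentation {V : Type (max u v)} [AddCommGroup V] [Module k V]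
    [FiniteDimensional k V] (ρ : Representation k H V) : (ofRepresentation ρ).groupRep = ρ :=
  MonoidHom.ext ρ.asAlgebraHom_of

end FDModule

/-- Isomorphic algebras have isomorphic representation groups. -/
def RepRing.congr {k : Type u} [Field k] {A B : Type v} [Ring A] [Algebra k A] [Ring B]
    [Algebra k B] (e : A ≃ₐ[k] B) : RepRing k B ≃+ RepRing k A :=
  GrothendieckK.congr (FDModule.comap e) (FDModule.comap e.symm) (FDModule.isSES_comap _)
    (FDModule.isSES_comap _) (FDModule.cls_comap_comap e.comp_symm)
    (FDModule.cls_comap_comap e.symm_comp)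

theorem RepRing.congr_domCongr_cls {k : Type u} [Field k] {H K : Type v} [Group H] [Group K]
    (e : H ≃* K) {V : Type (max u v)} [AddCommGroup V] [Module k V] [FiniteDimensional k V]
    (ρ : Representation k K V) :
    RepRing.congr (MonoidAlgebra.domCongr k k e) (RepRing.cls (FDModule.ofRepresentation ρ)) =
      RepRing.cls (FDModule.ofRepresentation (ρ.comp e.toMonoidHom)) := by
  have h : ρ.asAlgebraHom.comp (MonoidAlgebra.domCongr k k e : _ →ₐ[k] MonoidAlgebra k K) =
      Representation.asAlgebraHom (ρ.comp e.toMonoidHom) :=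
    MonoidAlgebra.algHom_ext (fun γ => by simp) (Subsingleton.elim _ _)
  exact (GrothendieckK.congr_cls ..).trans
    (FDModule.cls_congr (M := (FDModule.ofRepresentation ρ).comap _)
      (N := FDModule.ofRepresentation (ρ.comp e.toMonoidHom)) (LinearEquiv.refl k V)
      fun a v => congrArg (· v) (DFunLike.congr_fun h a))

namespace EquivariantBundle

variable {k : Type u} [Field k] {Γ : Type v} [Group Γ] {X : Type v} [MulAction Γ X]

/-- The product of a finite family of equivariant bundles. -/
def pi {ι : Type v} [Finite ι] (E : ι → EquivariantBundle k Γ X) : EquivariantBundle k Γ X where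
  fib x := ∀ i, (E i).fib x
  act γ _ _ h := LinearMap.piMap fun i => (E i).act γ h
  act_one x := LinearMap.ext fun v => funext fun i => DFunLike.congr_fun ((E i).act_one x) (v i)
  act_mul γ δ _ _ _ hx hy := LinearMap.ext fun v => funext fun i =>
    DFunLike.congr_fun ((E i).act_mul γ δ hx hy) (v i)

theorem isSES_pi_option {ι : Type v} [Finite ι] (E : Option ι → EquivariantBundle k Γ X) :
    IsSES (E none) (pi E) (pi fun i => E (some i)) := by
  classical
  exact ⟨fun x => LinearMap.single k (fun o => (E o).fib x) none,
    fun x => LinearMap.pi fun i => LinearMap.proj (some i),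
    fun γ x y h v => funext fun o =>
      (Pi.apply_single (fun o => (E o).act γ h) (fun _ => map_zero _) none v o).symm,
    fun _ _ _ _ _ => rfl,
    fun x => ⟨Pi.single_injective (M := fun o => (E o).fib x) none,
      exact_single_none fun o => (E o).fib x, fun s => ⟨fun o => o.rec 0 s, rfl⟩⟩⟩

theorem cls_pi {ι : Type v} [Fintype ι] (E : ι → EquivariantBundle k Γ X) :
    (pi E).cls = ∑ i, (E i).cls := by
  refine Fintype.induction_empty_option
    (P := fun ι _ => ∀ E : ι → EquivariantBundle k Γ X, (pi E).cls = ∑ i, (E i).cls)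
    (fun ι κ _ e ih E => ?_) (fun E => ?_) (fun ι _ ih E => ?_) ι E
  · let := Fintype.ofEquiv κ e.symm
    rw [← e.sum_comp, ← ih fun i => E (e i)]
    exact cls_congr (fun x => (LinearEquiv.piCongrLeft k (fun i => (E i).fib x) e).symm)
      fun _ _ _ _ _ => rfl
  · exact cls_zero fun x => inferInstanceAs (Subsingleton (∀ i : PEmpty, (E i).fib x))
  · rw [Fintype.sum_option, ← ih]
    exact GrothendieckK.cls_eq_add (isSES_pi_option E)

end EquivariantBundle

open MulAction

section Transport

variable {Γ X : Type*} [Group Γ] [MulAction Γ X] {x₀ : X}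

/-- A chosen group element carrying the base point `x₀` to a point of its orbit. -/
def transporter {x : X} (p : x ∈ orbit Γ x₀) : Γ :=
  p.choose

theorem transporter_smul {x : X} (p : x ∈ orbit Γ x₀) : transporter p • x₀ = x :=
  p.choose_spec

theorem transporter_inv_smul {x : X} (p : x ∈ orbit Γ x₀) : (transporter p)⁻¹ • x = x₀ :=
  inv_smul_eq_iff.2 (transporter_smul p).symm

/-- The element of the stabilizer of `x₀` obtained by going from `x₀` to `x` by the transporter,
from `x` to `y` by `γ`, and back to `x₀`. -/
def holonomy (γ : Γ) {x y : X} (h : γ • x = y) (p : x ∈ orbit Γ x₀) (q : y ∈ orbit Γ x₀) :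
    stabilizer Γ x₀ :=
  ⟨(transporter q)⁻¹ * γ * transporter p, by
    rw [mem_stabilizer_iff, mul_smul, mul_smul, transporter_smul, h, transporter_inv_smul]⟩

theorem holonomy_one {x : X} (h : (1 : Γ) • x = x) (p q : x ∈ orbit Γ x₀) : holonomy 1 h p q = 1 :=
  Subtype.ext (by simp [holonomy])

theorem holonomy_mul {γ δ : Γ} {x y z : X} (hx : δ • x = y) (hy : γ • y = z) (hz : (γ * δ) • x = z)
    (p : x ∈ orbit Γ x₀) (q : y ∈ orbit Γ x₀) (r : z ∈ orbit Γ x₀) :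
    holonomy (γ * δ) hz p r = holonomy γ hy q r * holonomy δ hx p q :=
  Subtype.ext (by simp [holonomy, mul_assoc])

theorem mem_orbit_of_smul_eq {γ : Γ} {x y : X} (h : γ • x = y) (q : y ∈ orbit Γ x₀) :
    x ∈ orbit Γ x₀ :=
  inv_smul_eq_iff.2 h.symm ▸ mem_orbit_of_mem_orbit γ⁻¹ q

end Transport

namespace EquivariantBundle

variable {k : Type u} [Field k] {Γ : Type v} [Group Γ] {X : Type v} [MulAction Γ X]

/-- The representation of the stabilizer of `x` on the fibre at `x`. -/
def fibreRep (E : EquivariantBundle k Γ X) (x : X) :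
    Representation k (stabilizer Γ x) (E.fib x) where
  toFun γ := E.act γ γ.2
  map_one' := E.act_one x
  map_mul' γ δ := E.act_mul γ δ δ.2 γ.2

/-- The fibre of a bundle at `x`, as a module over the group algebra of the stabilizer of `x`. -/
abbrev fibre (x : X) (E : EquivariantBundle k Γ X) :
    FDModule k (MonoidAlgebra k (stabilizer Γ x)) :=
  FDModule.ofRepresentation (E.fibreRep x)

theorem isSES_fibre (x : X) (L M N : EquivariantBundle k Γ X) (h : IsSES L M N) :
    FDModule.IsSES (L.fibre x) (M.fibre x) (N.fibre x) := by
  obtain ⟨f, g, hf, hg, he⟩ := h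
  exact ⟨f x, g x, intertwines_asAlgebraHom fun γ => hf γ γ.2,
    intertwines_asAlgebraHom fun γ => hg γ γ.2, he x⟩

/-- The bundle supported on the orbit of `x₀` induced from a representation `W` of the stabilizer
of `x₀`: its fibres are copies of `W`, transported along the transporters. Taking functions on
proofs of `x ∈ orbit Γ x₀` makes the fibre zero off the orbit. -/
def induced {x₀ : X} {W : Type (max u v)} [AddCommGroup W] [Module k W] [FiniteDimensional k W]
    (σ : Representation k (stabilizer Γ x₀) W) : EquivariantBundle k Γ X where
  fib x := PLift (x ∈ orbit Γ x₀) → W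
  act γ x y h := LinearMap.pi fun q =>
    σ (holonomy γ h (mem_orbit_of_smul_eq h q.down) q.down) ∘ₗ
      LinearMap.proj ⟨mem_orbit_of_smul_eq h q.down⟩
  act_one x := LinearMap.ext fun v => funext fun q => by
    simp [holonomy_one]
  act_mul γ δ x y z hx hy := LinearMap.ext fun v => funext fun r => by
    have hz : (γ * δ) • x = z := by rw [mul_smul, hx, hy]
    have hr := holonomy_mul hx hy hz (mem_orbit_of_smul_eq hz r.down)
      (mem_orbit_of_smul_eq hy r.down) r.down
    simp [hr]

theorem isSES_induced {x₀ : X} (L M N : FDModule k (MonoidAlgebra k (stabilizer Γ x₀)))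
    (h : FDModule.IsSES L M N) :
    IsSES (induced L.groupRep) (induced M.groupRep) (induced N.groupRep) := by
  obtain ⟨f, g, hf, hg, hinj, hexact, hsurj⟩ := h
  exact ⟨fun _ => LinearMap.piMap fun _ => f, fun _ => LinearMap.piMap fun _ => g,
    fun _ _ _ _ v => funext fun _ => hf _ _, fun _ _ _ _ v => funext fun _ => hg _ _,
    fun x => ⟨Function.Injective.piMap fun _ => hinj, exact_piMap fun _ => hexact,
      Function.Surjective.piMap fun _ => hsurj⟩⟩

theorem subsingleton_induced_fib {x₀ : X} {W : Type (max u v)} [AddCommGroup W] [Module k W]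
    [FiniteDimensional k W] (σ : Representation k (stabilizer Γ x₀) W) {x : X}
    (hx : x ∉ orbit Γ x₀) : Subsingleton ((induced σ).fib x) :=
  have : IsEmpty (PLift (x ∈ orbit Γ x₀)) := ⟨fun p => hx p.down⟩
  inferInstanceAs (Subsingleton (PLift (x ∈ orbit Γ x₀) → W))

/-- The fibre of an induced bundle at the base point is the representation it is induced from. -/
def inducedFibreEquiv {x₀ : X} {W : Type (max u v)} [AddCommGroup W] [Module k W]
    [FiniteDimensional k W] (σ : Representation k (stabilizer Γ x₀) W) :
    (PLift (x₀ ∈ orbit Γ x₀) → W) ≃ₗ[k] W :=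
  have p₀ : PLift (x₀ ∈ orbit Γ x₀) := ⟨mem_orbit_self x₀⟩
  have : Unique (PLift (x₀ ∈ orbit Γ x₀)) := uniqueOfSubsingleton p₀
  LinearEquiv.funUnique (PLift (x₀ ∈ orbit Γ x₀)) k W ≪≫ₗ
    LinearEquiv.ofBijective (σ ⟨transporter p₀.down, transporter_smul p₀.down⟩)
      (σ.apply_bijective _)

theorem inducedFibreEquiv_fibreRep {x₀ : X} {W : Type (max u v)} [AddCommGroup W] [Module k W]
    [FiniteDimensional k W] (σ : Representation k (stabilizer Γ x₀) W) (γ : stabilizer Γ x₀)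
    (v : PLift (x₀ ∈ orbit Γ x₀) → W) :
    inducedFibreEquiv σ ((induced σ).fibreRep x₀ γ v) = σ γ (inducedFibreEquiv σ v) := by
  let t : stabilizer Γ x₀ := ⟨transporter (mem_orbit_self x₀), transporter_smul _⟩
  change σ t (σ (t⁻¹ * γ * t) (v _)) = σ γ (σ t (v _))
  rw [← Module.End.mul_apply, ← map_mul, ← Module.End.mul_apply, ← map_mul, mul_assoc,
    mul_inv_cancel_left]

theorem cls_fibre_induced {x₀ : X} (M : FDModule k (MonoidAlgebra k (stabilizer Γ x₀))) :
    RepRing.cls ((induced M.groupRep).fibre x₀) = RepRing.cls M :=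
  FDModule.cls_congr (M := (induced M.groupRep).fibre x₀) (inducedFibreEquiv M.groupRep)
    (intertwines_of_of (ρ := ((induced M.groupRep).fibreRep x₀).asAlgebraHom) (σ := M.ρ)
      (f := (inducedFibreEquiv M.groupRep).toLinearMap) fun γ v =>
      (congrArg (inducedFibreEquiv M.groupRep)
        (DFunLike.congr_fun (Representation.asAlgebraHom_of _ γ) v)).trans
        (inducedFibreEquiv_fibreRep M.groupRep γ v))

theorem cls_fibre_induced_of_notMem {x₀ x : X} (hx : x ∉ orbit Γ x₀)
    (M : FDModule k (MonoidAlgebra k (stabilizer Γ x₀))) :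
    RepRing.cls ((induced M.groupRep).fibre x) = 0 :=
  FDModule.cls_zero (subsingleton_induced_fib M.groupRep hx)

theorem act_inv_act (E : EquivariantBundle k Γ X) {a : Γ} {x y : X} (h : a • x = y)
    (h' : a⁻¹ • y = x) (v : E.fib x) : E.act a⁻¹ h' (E.act a h v) = v := by
  rw [E.act_act (inv_mul_cancel a) h h' (one_smul Γ x), E.act_eq_self rfl]

theorem act_act_inv (E : EquivariantBundle k Γ X) {a : Γ} {x y : X} (h : a • x = y)
    (h' : a⁻¹ • y = x) (v : E.fib y) : E.act a h (E.act a⁻¹ h' v) = v := by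
  rw [E.act_act (mul_inv_cancel a) h' h (one_smul Γ y), E.act_eq_self rfl]

/-- A bundle is the product of the bundles induced from its fibres at the points of a system of
representatives of the orbits. -/
def fibEquivPiInduced (E : EquivariantBundle k Γ X) {ι : Type v} {r : ι → X}
    (hr : ∀ x, ∃! i, x ∈ orbit Γ (r i)) (x : X) :
    E.fib x ≃ₗ[k] ∀ i, (induced (E.fibreRep (r i))).fib x where
  toFun v i p := E.act _ (transporter_inv_smul p.down) v
  invFun w := E.act _ (transporter_smul (hr x).choose_spec.1)
    (w (hr x).choose ⟨(hr x).choose_spec.1⟩)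
  map_add' v w := funext fun i => funext fun p => map_add _ v w
  map_smul' c v := funext fun i => funext fun p => map_smul _ c v
  left_inv v := E.act_act_inv (transporter_smul (hr x).choose_spec.1)
    (transporter_inv_smul (hr x).choose_spec.1) v
  right_inv w := funext fun i => funext fun p => by
    obtain rfl := (hr x).choose_spec.2 i p.down
    exact E.act_inv_act (transporter_smul p.down) (transporter_inv_smul p.down) (w _ p)

theorem isHom_fibEquivPiInduced (E : EquivariantBundle k Γ X) {ι : Type v} [Finite ι] {r : ι → X}
    (hr : ∀ x, ∃! i, x ∈ orbit Γ (r i)) :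
    IsHom (F := pi fun i => induced (E.fibreRep (r i))) fun x =>
      (E.fibEquivPiInduced hr x).toLinearMap := fun γ x _ h v => funext fun i => funext fun q => by
  have p := mem_orbit_of_smul_eq h q.down
  have hx : ((transporter q.down)⁻¹ * γ) • x = r i := by
    rw [mul_smul, h, transporter_inv_smul]
  exact (E.act_act rfl h (transporter_inv_smul q.down) hx v).trans
    (E.act_act (mul_inv_cancel_right _ _) (transporter_inv_smul p)
      (holonomy γ h p q.down).2 hx v).symm

theorem cls_eq_sum_cls_induced (E : EquivariantBundle k Γ X) {ι : Type v} [Fintype ι] {r : ι → X}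
    (hr : ∀ x, ∃! i, x ∈ orbit Γ (r i)) :
    E.cls = ∑ i, (induced (E.fibre (r i)).groupRep).cls := by
  have hi (i : ι) : (E.fibre (r i)).groupRep = E.fibreRep (r i) :=
    FDModule.groupRep_ofRepresentation _
  rw [cls_congr (F := pi fun i => induced (E.fibreRep (r i))) (E.fibEquivPiInduced hr)
    (E.isHom_fibEquivPiInduced hr), cls_pi]
  exact Finset.sum_congr rfl fun i _ => congrArg (fun σ => (induced σ).cls) (hi i).symm

end EquivariantBundle

namespace EquivariantK

variable {k : Type u} [Field k] {Γ : Type v} [Group Γ] {X : Type v} [MulAction Γ X] {ι : Type v}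
  [Fintype ι] {r : ι → X}

/-- The fibre at `x` of classes of equivariant bundles. -/
def fibreHom (x : X) : EquivariantK k Γ X →+ RepRing k (MonoidAlgebra k (stabilizer Γ x)) :=
  GrothendieckK.map (EquivariantBundle.fibre x) (EquivariantBundle.isSES_fibre x)

/-- The induction of classes of representations of the stabilizer of `x`. -/
def inducedHom (x : X) : RepRing k (MonoidAlgebra k (stabilizer Γ x)) →+ EquivariantK k Γ X :=
  GrothendieckK.map (fun M => EquivariantBundle.induced M.groupRep)
    EquivariantBundle.isSES_induced

theorem fibreHom_comp_inducedHom (x : X) :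
    (fibreHom x).comp (inducedHom x) =
      AddMonoidHom.id (RepRing k (MonoidAlgebra k (stabilizer Γ x))) :=
  GrothendieckK.hom_ext fun M => by
    simpa [fibreHom, inducedHom] using EquivariantBundle.cls_fibre_induced M

theorem fibreHom_comp_inducedHom_of_notMem {x y : X} (h : x ∉ orbit Γ y) :
    (fibreHom (k := k) (Γ := Γ) x).comp (inducedHom y) = 0 :=
  GrothendieckK.hom_ext fun M => by
    simpa [fibreHom, inducedHom] using EquivariantBundle.cls_fibre_induced_of_notMem h M

theorem sum_inducedHom_comp_fibreHom (hr : ∀ x, ∃! i, x ∈ orbit Γ (r i)) :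
    ∑ i, (inducedHom (r i)).comp (fibreHom (r i)) = AddMonoidHom.id (EquivariantK k Γ X) :=
  GrothendieckK.hom_ext fun E => by
    simpa [AddMonoidHom.finsetSum_apply, fibreHom, inducedHom] using
      (E.cls_eq_sum_cls_induced hr).symm

/-- The orbit decomposition of equivariant `K`-theory: a class is determined by its fibres, as
representations of the stabilizers, at a finite system of representatives of the orbits. -/
def addEquivPi (hr : ∀ x, ∃! i, x ∈ orbit Γ (r i)) :
    EquivariantK k Γ X ≃+ ∀ i, RepRing k (MonoidAlgebra k (stabilizer Γ (r i))) :=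
  addEquivPiOfBiproduct (fun i => fibreHom (r i)) (fun i => inducedHom (r i))
    (fun i => fibreHom_comp_inducedHom (r i))
    (fun i _ hne => fibreHom_comp_inducedHom_of_notMem fun h =>
      hne ((hr (r i)).unique (mem_orbit_self (r i)) h))
    (sum_inducedHom_comp_fibreHom hr)

theorem addEquivPi_cls (hr : ∀ x, ∃! i, x ∈ orbit Γ (r i)) (E : EquivariantBundle k Γ X) (i : ι) :
    addEquivPi hr E.cls i = RepRing.cls (E.fibre (r i)) :=
  GrothendieckK.map_cls _ (EquivariantBundle.isSES_fibre (r i)) E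

end EquivariantK

section Centralizer

variable {G : Type*} [Group G]

/-- The centralizer of `g` is its stabilizer under conjugation. -/
def centralizerEquivStabilizer (g : G) :
    Subgroup.centralizer ({g} : Set G) ≃* stabilizer (ConjAct G) g where
  toEquiv := ConjAct.toConjAct.toEquiv.subtypeEquiv fun x => by
    rw [Subgroup.centralizer_eq_comap_stabilizer]
    rfl
  map_mul' _ _ := rfl

theorem existsUnique_mem_orbit_conjAct {r : ConjClasses G → G} (hr : ∀ c, ConjClasses.mk (r c) = c)
    (g : G) : ∃! c, g ∈ orbit (ConjAct G) (r c) := by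
  have hmem (c : ConjClasses G) : g ∈ orbit (ConjAct G) (r c) ↔ c = ConjClasses.mk g := by
    rw [ConjAct.mem_orbit_conjAct, ← ConjClasses.mk_eq_mk_iff_isConj, hr, eq_comm]
  simp only [hmem, existsUnique_eq]

end Centralizer

namespace KFull

variable {k : Type u} [Field k] {G : Type v} [Group G] [Fintype (ConjClasses G)]

/-- The identification of full `K`-theory with the sum of the representation groups of the
centralizers of a system of representatives `r` of the conjugacy classes. -/
def addEquivDirectSum {r : ConjClasses G → G} (hr : ∀ c, ConjClasses.mk (r c) = c) :
    KFull k G ≃+ ⨁ c : ConjClasses G,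
      RepRing k (MonoidAlgebra k (Subgroup.centralizer ({r c} : Set G))) :=
  ((EquivariantK.addEquivPi (existsUnique_mem_orbit_conjAct hr)).trans
    (AddEquiv.piCongrRight fun c =>
      RepRing.congr (MonoidAlgebra.domCongr k k (centralizerEquivStabilizer (r c))))).trans
    (DirectSum.addEquivProd _).symm

theorem addEquivDirectSum_cls {r : ConjClasses G → G} (hr : ∀ c, ConjClasses.mk (r c) = c)
    (E : EquivariantBundle k (ConjAct G) G) (c : ConjClasses G) :
    addEquivDirectSum hr (cls E) c =
      RepRing.cls (FDModule.ofRepresentation (E.sectorRep (r c))) := by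
  have hc := congrArg
    (RepRing.congr (MonoidAlgebra.domCongr k k (centralizerEquivStabilizer (r c))))
    (EquivariantK.addEquivPi_cls (existsUnique_mem_orbit_conjAct hr) E c)
  exact hc.trans (RepRing.congr_domCongr_cls _ (E.fibreRep (r c)))

end KFull

end

theorem mainTheorem1 (k : Type u) [Field k] (G : Type v) [Group G] [Fintype G] [DecidableEq G] :
    (∃ Φ : KFull k G ≃+* RepRing k (DrinfeldDouble k G), Φ 1 = 1) ∧
    (∀ r : ConjClasses G → G, (∀ c, ConjClasses.mk (r c) = c) →
      ∃ Ψ : KFull k G ≃+ ⨁ c : ConjClasses G,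
          RepRing k (MonoidAlgebra k (Subgroup.centralizer ({r c} : Set G))),
        ∀ (E : EquivariantBundle k (ConjAct G) G) (c : ConjClasses G),
          Ψ (KFull.cls E) c = RepRing.cls (FDModule.ofRepresentation (E.sectorRep (r c)))) :=
  ⟨⟨KFull.ringEquivRepRing, KFull.ringEquivRepRing_one⟩,
    fun _ hr => ⟨KFull.addEquivDirectSum hr, KFull.addEquivDirectSum_cls hr⟩⟩
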